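/- Let $SG\subset\mathbb{R}^2$ be the Sierpinski gasket whose outer triangle $\Delta_{0,1}$ is equilateral of circumference $2\pi$ with one vertex pointing upwards, and let $\nabla_{m,k}$ ($m\ge 1$, $1\le k\le 3^{m-1}$), of circumference $2\pi\cdot 2^{-m}$, be the upside down triangles bounding the holes of $SG$. For a triangle $T$ among these, of circumference $2\pi r$, let $r_T$ be a parametrization of $T$ by arc length on the circle $\mathbb{T}_r$ of radius $r$, counterclockwise for $T=\nabla_{m,k}$ and clockwise for $T=\Delta_{0,1}$. Put $H_T=L^2(\mathbb{T}_r)$, let $\pi_T(f)$, $f\in C(SG)$, be multiplication by $f\circ r_T$, and let $D_T=-i\frac{d}{dx}+\frac1{2r}$ be the self-adjoint operator on $H_T$ with eigenvectors $e^{ikx/r}$ and eigenvalues $(k+\frac12)/r$, $k\in\mathbb{Z}$. The triple $ZGT$ is the direct sum of $(H_T,\pi_T,D_T)$ over $T=\Delta_{0,1}$ and all $T=\nabla_{m,k}$. Let $RGT$ be a reduced triple, obtained from $ZGT$ by leaving out any single one of these summands, with representation $\pi_{RGT}$ and Dirac operator $D_{RGT}$, and for $x,y\in SG$ let $$d_{RGT}(x,y)=\sup\{|f(x)-f(y)|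 : f\in C(SG),\ \|[D_{RGT},\pi_{RGT}(f)]\|\le 1\},$$ where the condition means that $\pi_{RGT}(f)$ maps the domain of $D_{RGT}$ into itself and the commutator is bounded on it with norm at most $1$. Let $d_g(x,y)$ be the geodesic distance, the infimum of the lengths of the curves in $SG$ from $x$ to $y$. Then, for every such $RGT$, both $d_g$ and $d_{RGT}$ are finite on $SG\times SG$, and they are equivalent metrics: there are constants $c,C>0$ with $c\,d_g(x,y)\le d_{RGT}(x,y)\le C\,d_g(x,y)$ for all $x,y\in SG$. But $d_{RGT}\ne d_g$: there exist points $x\ne y$ in $SG$ with $$d_{RGT}(x,y)\ \ge\ \tfrac32\, d_g(x,y).$$ -/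

import Mathlib

open scoped ENNReal NNReal

noncomputable section

namespace Gasket

/-! ### Unbounded operators and the Connes distance -/

section Operators

variable {H : Type*} [NormedAddCommGroup H] [InnerProductSpace ℂ H]

/-- The vectors `ξ` such that `∑ |ev n|² |⟨b n, ξ⟩|² < ∞`. -/
def diagonalDomain {ι : Type*} (b : HilbertBasis ι ℂ H) (ev : ι → ℝ) : Submodule ℂ H where
  carrier := {ξ | Memℓp (fun n => (ev n : ℂ) * b.repr ξ n) 2}
  zero_mem' := by
    have : (fun n => (ev n : ℂ) * b.repr (0 : H) n) = 0 := by ext n; simp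
    rw [Set.mem_ofPred_eq, this]
    exact zero_memℓp
  add_mem' := by
    intro x y hx hy
    have : (fun n => (ev n : ℂ) * b.repr (x + y) n)
        = (fun n => (ev n : ℂ) * b.repr x n) + fun n => (ev n : ℂ) * b.repr y n := by
      ext n; simp [mul_add]
    rw [Set.mem_ofPred_eq, this]
    exact Memℓp.add hx hy
  smul_mem' := by
    intro c x hx
    have : (fun n => (ev n : ℂ) * b.repr (c • x) n)
        = c • fun n => (ev n : ℂ) * b.repr x n := by
      ext n; simp only [map_smul, lp.coeFn_smul, Pi.smul_apply, smul_eq_mul]; ring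
    rw [Set.mem_ofPred_eq, this]
    exact Memℓp.const_smul hx c

/-- The (self-adjoint) operator with eigenvectors `b n` and real eigenvalues `ev n`, on its
maximal domain. -/
def diagonalOperator {ι : Type*} (b : HilbertBasis ι ℂ H) (ev : ι → ℝ) : H →ₗ.[ℂ] H where
  domain := diagonalDomain b ev
  toFun :=
    { toFun := fun ξ => b.repr.symm
        (⟨fun n => (ev n : ℂ) * b.repr (ξ : H) n, ξ.2⟩ : lp (fun _ : ι => ℂ) 2)
      map_add' := fun x y => by
        rw [← LinearIsometryEquiv.map_add]
        refine congrArg _ (Subtype.ext (funext fun n => ?_))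
        have h : b.repr ((x + y : diagonalDomain b ev) : H) n
            = b.repr (x : H) n + b.repr (y : H) n := by
          rw [Submodule.coe_add, map_add, lp.coeFn_add, Pi.add_apply]
        exact (congrArg _ h).trans (mul_add _ _ _)
      map_smul' := fun c x => by
        rw [RingHom.id_apply, ← LinearIsometryEquiv.map_smul]
        refine congrArg _ (Subtype.ext (funext fun n => ?_))
        have h : b.repr ((c • x : diagonalDomain b ev) : H) n = c * b.repr (x : H) n := by
          rw [Submodule.coe_smul, map_smul, lp.coeFn_smul, Pi.smul_apply, smul_eq_mul]
        exact (congrArg _ h).trans (mul_left_comm _ _ _) }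

/-- `[D, a]` is everywhere defined on `dom D` (that is, `a` maps `dom D` into itself)
and is bounded there, with norm at most `K`. -/
def CommutatorBoundedBy (D : H →ₗ.[ℂ] H) (a : H →L[ℂ] H) (K : ℝ) : Prop :=
  ∀ ξ : D.domain, ∃ h : a ξ.1 ∈ D.domain, ‖D ⟨a ξ.1, h⟩ - a (D ξ)‖ ≤ K * ‖ξ.1‖

/-- The distance on the space `X` given by Connes' formula for the representation `π` of `C(X)`
and the Dirac operator `D`:
`d(x, y) = sup {|f(x) - f(y)| : f ∈ C(X), ‖[D, π(f)]‖ ≤ 1}` (a priori possibly infinite). -/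
def connesDist {X : Type*} [TopologicalSpace X] (π : C(X, ℂ) → H →L[ℂ] H) (D : H →ₗ.[ℂ] H)
    (x y : X) : ℝ≥0∞ :=
  ⨆ (f : C(X, ℂ)) (_ : CommutatorBoundedBy D (π f) 1), edist (f x) (f y)

end Operators

section DirectSum

variable {ι : Type*} {H : ι → Type*} [∀ i, NormedAddCommGroup (H i)]
  [∀ i, InnerProductSpace ℂ (H i)]

/-- The direct sum of the unbounded operators `D i`, on the Hilbert space direct sum. Its domain
consists of the `ξ` with `ξ i ∈ dom (D i)` for all `i` and `∑ ‖D i (ξ i)‖² < ∞`. -/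
def directSumOperator (D : ∀ i, H i →ₗ.[ℂ] H i) : lp H 2 →ₗ.[ℂ] lp H 2 where
  domain :=
    { carrier := {ξ | ∃ h : ∀ i, ξ i ∈ (D i).domain, Memℓp (fun i => D i ⟨ξ i, h i⟩) 2}
      zero_mem' := by
        refine ⟨fun i => (D i).domain.zero_mem, ?_⟩
        have : (fun i => D i ⟨(0 : lp H 2) i, (D i).domain.zero_mem⟩) = 0 := by
          ext i
          exact (D i).map_zero
        rw [this]
        exact zero_memℓp
      add_mem' := by
        rintro x y ⟨hx, hx'⟩ ⟨hy, hy'⟩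
        refine ⟨fun i => (D i).domain.add_mem (hx i) (hy i), ?_⟩
        have : (fun i => D i ⟨(x + y : lp H 2) i, (D i).domain.add_mem (hx i) (hy i)⟩)
            = (fun i => D i ⟨x i, hx i⟩) + fun i => D i ⟨y i, hy i⟩ := by
          ext i
          exact (D i).map_add ⟨x i, hx i⟩ ⟨y i, hy i⟩
        rw [this]
        exact hx'.add hy'
      smul_mem' := by
        rintro c x ⟨hx, hx'⟩
        refine ⟨fun i => (D i).domain.smul_mem c (hx i), ?_⟩
        have : (fun i => D i ⟨(c • x : lp H 2) i, (D i).domain.smul_mem c (hx i)⟩)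
            = c • fun i => D i ⟨x i, hx i⟩ := by
          ext i
          exact (D i).map_smul c ⟨x i, hx i⟩
        rw [this]
        exact hx'.const_smul c }
  toFun :=
    { toFun := fun ξ => ⟨fun i => D i ⟨ξ.1 i, ξ.2.1 i⟩, ξ.2.2⟩
      map_add' := by
        intro x y
        ext i
        exact (D i).map_add ⟨x.1 i, x.2.1 i⟩ ⟨y.1 i, y.2.1 i⟩
      map_smul' := by
        intro c x
        ext i
        exact (D i).map_smul c ⟨x.1 i, x.2.1 i⟩ }

end DirectSum

/-! ### The gasket -/

/-- The vertices of the outer triangle `Δ_{0,1}`: equilateral, of circumference `2π`, one vertex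
pointing upwards, listed counterclockwise. The plane is `ℂ`. -/
def corner : Fin 3 → ℂ :=
  ![0, ⟨2 * Real.pi / 3, 0⟩, ⟨Real.pi / 3, Real.sqrt 3 * Real.pi / 3⟩]

/-- The contraction with ratio `1/2` towards the `i`-th corner. -/
def contraction (i : Fin 3) (z : ℂ) : ℂ := (z + corner i) / 2

/-- The composition `S_{i₁} ∘ ⋯ ∘ S_{iₙ}` of the contractions along the word `i₁ ⋯ iₙ`. -/
def wordMap : List (Fin 3) → ℂ → ℂ
  | [], z => z
  | i :: w, z => contraction i (wordMap w z)

/-- The boundary (union of the three edges) of the triangle with vertices `v`. -/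
def triangleEdges (v : Fin 3 → ℂ) : Set ℂ :=
  segment ℝ (v 0) (v 1) ∪ segment ℝ (v 1) (v 2) ∪ segment ℝ (v 2) (v 0)

/-- The vertices of the triangle of the form `Δ_{n,j}`, `n` the length of `w`, that is
the image of the outer triangle under the word `w`. The `3ⁿ` words of length `n` number
these triangles. -/
def cellVertices (w : List (Fin 3)) : Fin 3 → ℂ := fun i => wordMap w (corner i)

/-- The Sierpinski gasket: the closure of the union of all the triangles `Δ_{n,j}`. -/
def gasket : Set ℂ := closure (⋃ w : List (Fin 3), triangleEdges (cellVertices w))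

/-- The vertices, counterclockwise, of the central upside down triangle `∇_{1,1}`. -/
def middle : Fin 3 → ℂ :=
  ![(corner 0 + corner 1) / 2, (corner 1 + corner 2) / 2, (corner 2 + corner 0) / 2]

/-- The geodesic distance on the gasket: the infimum of the lengths of the curves in the gasket
from `x` to `y`. -/
def geodesicDist (x y : gasket) : ℝ≥0∞ :=
  ⨅ γ : Path x y, eVariationOn (γ : unitInterval → gasket) Set.univ

/-! ### The triangles that occur as summands and their parametrizations -/

/-- The summands of the triple `ZGT`: the outer triangle, and, for each word `w`, the upside down
triangle bounding the hole which is the image of the central hole under `w`. The upside down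
triangles `∇_{m,k}`, `1 ≤ k ≤ 3^(m-1)`, correspond to the words of length `m - 1`. -/
inductive Summand : Type
  | outer : Summand
  | hole : List (Fin 3) → Summand

/-- The vertices of the triangle in the order of its parametrization: counterclockwise for the
upside down triangles, clockwise (reversed orientation) for the outer triangle. -/
def Summand.vertices : Summand → Fin 3 → ℂ
  | .outer => ![corner 0, corner 2, corner 1]
  | .hole w => fun i => wordMap w (middle i)

/-- The radius of the circle associated with the triangle: `1` for `Δ_{0,1}`,
`2⁻ᵐ` for `∇_{m,k}`. -/
def Summand.radius : Summand → ℝ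
  | .outer => 1
  | .hole w => (1 / 2) ^ (w.length + 1)

/-- The circumference of the triangle. -/
def Summand.perimeter (s : Summand) : ℝ := 2 * Real.pi * s.radius

theorem Summand.radius_pos (s : Summand) : 0 < s.radius := by
  cases s <;> simp [Summand.radius]

instance Summand.perimeter_pos (s : Summand) : Fact (0 < s.perimeter) :=
  ⟨mul_pos (by positivity) s.radius_pos⟩

/-- The parametrization of the boundary of an equilateral triangle with vertices `v` and
circumference `T` by arc length `t ∈ [0, T]`, starting at `v 0`. -/
def triangleParam (v : Fin 3 → ℂ) (T t : ℝ) : ℂ :=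
  if t ≤ T / 3 then AffineMap.lineMap (v 0) (v 1) (3 * t / T)
  else if t ≤ 2 * T / 3 then AffineMap.lineMap (v 1) (v 2) (3 * t / T - 1)
  else AffineMap.lineMap (v 2) (v 0) (3 * t / T - 2)

theorem continuous_triangleParam (v : Fin 3 → ℂ) {T : ℝ} (hT : 0 < T) :
    Continuous (triangleParam v T) := by
  unfold triangleParam
  refine Continuous.if_le (by fun_prop) (Continuous.if_le (by fun_prop) (by fun_prop)
    continuous_id continuous_const ?_) continuous_id continuous_const ?_
  · rintro t rfl
    have h1 : 3 * (2 * T / 3) / T - 1 = 1 := by field_simp; norm_num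
    have h2 : 3 * (2 * T / 3) / T - 2 = 0 := by field_simp; norm_num
    rw [h1, h2]; simp
  · rintro t rfl
    have h1 : 3 * (T / 3) / T = 1 := by field_simp
    rw [if_pos (by linarith), h1]; simp

theorem triangleParam_closed (v : Fin 3 → ℂ) {T : ℝ} (hT : 0 < T) :
    triangleParam v T 0 = triangleParam v T T := by
  have h1 : 3 * T / T - 2 = 1 := by field_simp; norm_num
  simp only [triangleParam]
  rw [if_pos (by linarith), if_neg (by linarith), if_neg (by linarith), h1]
  simp

theorem triangleParam_mem (v : Fin 3 → ℂ) {T : ℝ} (hT : 0 < T) {t : ℝ} (h0 : 0 ≤ t)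
    (h1 : t ≤ T) : triangleParam v T t ∈ triangleEdges v := by
  have key : ∀ (a b : ℂ) (u : ℝ), 0 ≤ u → u ≤ 1 → AffineMap.lineMap a b u ∈ segment ℝ a b := by
    intro a b u hu0 hu1
    rw [segment_eq_image_lineMap]
    exact ⟨u, ⟨hu0, hu1⟩, rfl⟩
  unfold triangleParam triangleEdges
  split_ifs with h2 h3
  · refine Or.inl (Or.inl (key _ _ _ (by positivity) ?_))
    rw [div_le_one hT]; linarith
  · refine Or.inl (Or.inr (key _ _ _ ?_ ?_))
    · rw [sub_nonneg, one_le_div hT]; linarith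
    · rw [sub_le_iff_le_add, div_le_iff₀ hT]; linarith
  · refine Or.inr (key _ _ _ ?_ ?_)
    · rw [sub_nonneg, le_div_iff₀ hT]; linarith
    · rw [sub_le_iff_le_add, div_le_iff₀ hT]; linarith

theorem wordMap_append_singleton (w : List (Fin 3)) (i : Fin 3) (z : ℂ) :
    wordMap (w ++ [i]) z = wordMap w (contraction i z) := by
  induction w with
  | nil => rfl
  | cons j w ih => simp [wordMap, ih]

theorem triangleEdges_vertices_subset (s : Summand) : triangleEdges s.vertices ⊆ gasket := by
  refine Set.Subset.trans ?_ subset_closure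
  cases s with
  | outer =>
    refine Set.Subset.trans ?_ (Set.subset_iUnion _ [])
    have h : cellVertices [] = corner := rfl
    rw [h]
    rintro z ((hz | hz) | hz)
    · exact Or.inr (by rw [segment_symm]; exact hz)
    · exact Or.inl (Or.inr (by rw [segment_symm]; exact hz))
    · exact Or.inl (Or.inl (by rw [segment_symm]; exact hz))
  | hole w =>
    have hm : ∀ i j k, middle k = contraction i (corner j) →
        (Summand.hole w).vertices k = cellVertices (w ++ [i]) j := by
      intro i j k h
      simp only [Summand.vertices, cellVertices, wordMap_append_singleton, h]
    rintro z ((hz | hz) | hz)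
    · rw [hm 1 0 0 rfl, hm 1 2 1 (by simp [middle, contraction, add_comm])] at hz
      rw [segment_symm] at hz
      exact Set.mem_iUnion.2 ⟨w ++ [1], Or.inr hz⟩
    · rw [hm 2 1 1 rfl, hm 2 0 2 (by simp [middle, contraction, add_comm])] at hz
      rw [segment_symm] at hz
      exact Set.mem_iUnion.2 ⟨w ++ [2], Or.inl (Or.inl hz)⟩
    · rw [hm 0 2 2 rfl, hm 0 1 0 (by simp [middle, contraction, add_comm])] at hz
      rw [segment_symm] at hz
      exact Set.mem_iUnion.2 ⟨w ++ [0], Or.inl (Or.inr hz)⟩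

theorem gasket_isCompact : IsCompact gasket := by
  set R : ℝ := ‖corner 0‖ + ‖corner 1‖ + ‖corner 2‖ with hR
  have hc : ∀ i, ‖corner i‖ ≤ R := by
    have h0 := norm_nonneg (corner 0)
    have h1 := norm_nonneg (corner 1)
    have h2 := norm_nonneg (corner 2)
    intro i
    fin_cases i <;> simp only [hR, Fin.zero_eta, Fin.mk_one, Fin.reduceFinMk] <;> linarith
  have hw : ∀ (w : List (Fin 3)) (z : ℂ), ‖z‖ ≤ R → ‖wordMap w z‖ ≤ R := by
    intro w z hz
    induction w with
    | nil => exact hz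
    | cons i w ih =>
      simp only [wordMap, contraction, norm_div, Complex.norm_ofNat]
      have := norm_add_le (wordMap w z) (corner i)
      have := hc i
      linarith
  have hv : ∀ w i, cellVertices w i ∈ Metric.closedBall (0 : ℂ) R := fun w i => by
    rw [mem_closedBall_zero_iff]; exact hw w _ (hc i)
  have hsub : gasket ⊆ Metric.closedBall 0 R := by
    refine closure_minimal (Set.iUnion_subset fun w => ?_) Metric.isClosed_closedBall
    have hcv := convex_closedBall (0 : ℂ) R
    exact Set.union_subset (Set.union_subset (hcv.segment_subset (hv w 0) (hv w 1))
      (hcv.segment_subset (hv w 1) (hv w 2))) (hcv.segment_subset (hv w 2) (hv w 0))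
  exact (isCompact_closedBall 0 R).of_isClosed_subset isClosed_closure hsub

instance : CompactSpace gasket := isCompact_iff_compactSpace.1 gasket_isCompact

/-- The parametrization by arc length of the triangle `s`, on a circle of the same
circumference. -/
def Summand.loop (s : Summand) : C(AddCircle s.perimeter, gasket) where
  toFun q :=
    ⟨AddCircle.liftIco s.perimeter 0 (triangleParam s.vertices s.perimeter) q, by
      obtain ⟨t, ht, rfl⟩ : q ∈ ((↑) : ℝ → AddCircle s.perimeter) '' Set.Ico 0 (0 + s.perimeter) := by
        rw [AddCircle.coe_image_Ico_eq]; trivial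
      rw [AddCircle.liftIco_coe_apply ht]
      exact triangleEdges_vertices_subset s
        (triangleParam_mem _ s.perimeter_pos.out ht.1 (by linarith [ht.2]))⟩
  continuous_toFun := by
    refine Continuous.subtype_mk (AddCircle.liftIco_zero_continuous
      (triangleParam_closed _ s.perimeter_pos.out)
      (continuous_triangleParam _ s.perimeter_pos.out).continuousOn) _

/-! ### The unbounded Fredholm module of a triangle -/

/-- The Hilbert space of square integrable functions on the circle of circumference `T`, with
respect to normalized arc length. -/
abbrev CircleL2 (T : ℝ) [Fact (0 < T)] : Type :=
  MeasureTheory.Lp ℂ 2 (AddCircle.haarAddCircle (T := T))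

/-- The Dirac operator of the circle of radius `r`, transported to the triangle `s`:
`-i d/dx + 1/(2r)`, that is, the operator whose eigenvectors are the functions
`exp (i k x / r)`, with eigenvalues `(k + 1/2) / r`, `k ∈ ℤ`. -/
def Summand.dirac (s : Summand) : CircleL2 s.perimeter →ₗ.[ℂ] CircleL2 s.perimeter :=
  diagonalOperator fourierBasis fun k : ℤ => ((k : ℝ) + 1 / 2) / s.radius

/-- The operator of multiplication by a continuous function on `L²` of the circle. -/
def mulOperator {T : ℝ} [Fact (0 < T)] (g : C(AddCircle T, ℂ)) : CircleL2 T →L[ℂ] CircleL2 T :=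
  (ContinuousLinearMap.mul ℂ ℂ).holderL (AddCircle.haarAddCircle (T := T)) ∞ 2 2
    (ContinuousMap.toLp ∞ AddCircle.haarAddCircle ℂ g)

theorem norm_mulOperator_le {T : ℝ} [Fact (0 < T)] (g : C(AddCircle T, ℂ)) :
    ‖mulOperator g‖ ≤ ‖g‖ := by
  have h1 : ‖ContinuousMap.toLp ∞ (AddCircle.haarAddCircle (T := T)) ℂ g‖ ≤ ‖g‖ := by
    refine (ContinuousLinearMap.le_of_opNorm_le _ (ContinuousMap.toLp_norm_le (𝕜 := ℂ) _) g).trans ?_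
    simp
  have h2 := ContinuousLinearMap.norm_holderL_le (r := 2) (p := ∞) (q := 2)
    (μ := AddCircle.haarAddCircle (T := T)) (ContinuousLinearMap.mul ℂ ℂ)
  refine (ContinuousLinearMap.le_opNorm _ _).trans ?_
  calc _ ≤ 1 * ‖g‖ := mul_le_mul (h2.trans (ContinuousLinearMap.opNorm_mul_le ℂ ℂ)) h1
        (norm_nonneg _) zero_le_one
    _ = ‖g‖ := one_mul _

/-- The representation of `C(SG)` given by the triangle `s`: multiplication by the restriction
of the function to the triangle. -/
def Summand.rep (s : Summand) (f : C(gasket, ℂ)) : CircleL2 s.perimeter →L[ℂ] CircleL2 s.perimeter :=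
  mulOperator (f.comp s.loop)

theorem Summand.norm_rep_le (s : Summand) (f : C(gasket, ℂ)) : ‖s.rep f‖ ≤ ‖f‖ :=
  (norm_mulOperator_le _).trans
    ((ContinuousMap.norm_le _ (norm_nonneg f)).2 fun _ => f.norm_coe_le_norm _)

/-! ### Direct sums of the modules of the triangles -/

/-- The Hilbert space of the direct sum of the modules of the triangles in `J`. -/
abbrev SumSpace (J : Set Summand) : Type := lp (fun s : J => CircleL2 s.1.perimeter) 2

/-- The representation of `C(SG)` on the direct sum of the modules of the triangles in `J`. -/
def sumRep (J : Set Summand) (f : C(gasket, ℂ)) : SumSpace J →L[ℂ] SumSpace J :=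
  lp.mapCLM 2 (fun s : J => s.1.rep f) (norm_nonneg f) fun s => s.1.norm_rep_le f

/-- The Dirac operator of the direct sum of the modules of the triangles in `J`. -/
def sumDirac (J : Set Summand) : SumSpace J →ₗ.[ℂ] SumSpace J :=
  directSumOperator fun s : J => s.1.dirac

/-- The distance on the gasket induced by the reduced triple `RGT` which is obtained from `ZGT`
(the direct sum over all the triangles) by leaving out the summand `s`. -/
def distRGT (s : Summand) (x y : gasket) : ℝ≥0∞ :=
  connesDist (sumRep {s}ᶜ) (sumDirac {s}ᶜ) x y

end Gasket

end

noncomputable section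

namespace Gasket

/-! The Dirac operator of one triangle generates the translations of its circle, up to a phase, and
multiplication by `g` commutes with translation by `t` up to multiplication by `g - g(· + t)`. Hence
the commutator with `f` is bounded by `1` exactly when `f` is `1`-Lipschitz for arc length on that
triangle (`Summand.commutatorBoundedBy_iff`). In a direct sum this has to hold on every summand, so
`distRGT s` is the supremum of `|f x - f y|` over the continuous `f` that are arc length
`1`-Lipschitz on all triangles except `s` (`distRGT_eq`). From here on the problem is one of metric
geometry.

Equivalence: both distances are comparable with the Euclidean one. They dominate it, because curves
are at least as long as chords and because the inclusion of the gasket into `ℂ` is an admissible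
function. Conversely, a pseudo-distance for which cells of level `n` have diameter `O(2⁻ⁿ)` is
dominated by the Euclidean distance (`le_const_mul_dist`): when two points are separated into two
cells, these meet in a vertex, and the Euclidean distance controls how far both points are from it.
The diameter bound for `geodesicDist` comes from infinite polygons of geometrically decreasing
length. For an admissible `f` it comes from chains of touching holes; cells that contain the omitted
hole are handled by passing through the common vertices of smaller cells.

Difference: if the outer triangle is omitted, nothing forces slope `1` on the bottom side, as the
holes meet it only in single points. The function `steep`, the fixed point of a self-similar
contraction, is `1`-Lipschitz on every hole and on the other two sides, yet rises by `3/2` of the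
side length along the bottom. It is a scaled copy of itself on the left cell, of a companion
`steepLow` on the right cell, and affine on the top cell. If a hole is omitted, its top edge is the
bottom side of a cell; a copy of the average of `steep` and `steepLow` is put there, tapered to `0`
through the neighbouring cells and extended by `0` (`exists_steep_at_hole`). -/

open Filter Topology

/-! ### Diagonal operators, their unitary groups and bounded commutators -/

section Diagonal

variable {H : Type*} [NormedAddCommGroup H] [InnerProductSpace ℂ H] {ι : Type*}

/-- `ξ` lies in the domain of the diagonal operator with eigenvalues `ev`, which maps it to `ζ`. -/
def IsDiagonalImage (b : HilbertBasis ι ℂ H) (ev : ι → ℝ) (ξ ζ : H) : Prop :=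
  ∀ n, b.repr ζ n = (ev n : ℂ) * b.repr ξ n

variable {b : HilbertBasis ι ℂ H} {ev : ι → ℝ}

theorem hilbertBasis_ext (b : HilbertBasis ι ℂ H) {x y : H} (h : ∀ n, b.repr x n = b.repr y n) :
    x = y :=
  b.repr.injective (Subtype.ext (funext h))

theorem isDiagonalImage_apply (ξ : (diagonalOperator b ev).domain) :
    IsDiagonalImage b ev ξ (diagonalOperator b ev ξ) := by
  intro n
  change b.repr (b.repr.symm _) n = _
  rw [LinearIsometryEquiv.apply_symm_apply]

theorem IsDiagonalImage.mem_domain {ξ ζ : H} (h : IsDiagonalImage b ev ξ ζ) :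
    ξ ∈ (diagonalOperator b ev).domain := by
  change Memℓp (fun n => (ev n : ℂ) * b.repr ξ n) 2
  rw [show (fun n => (ev n : ℂ) * b.repr ξ n) = b.repr ζ from funext fun n => (h n).symm]
  exact lp.memℓp _

theorem IsDiagonalImage.apply_eq {ξ ζ : H} (h : IsDiagonalImage b ev ξ ζ)
    (h' : ξ ∈ (diagonalOperator b ev).domain) : diagonalOperator b ev ⟨ξ, h'⟩ = ζ :=
  hilbertBasis_ext b fun n => (isDiagonalImage_apply (b := b) (ev := ev) ⟨ξ, h'⟩ n).trans (h n).symm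

/-- Passing to the graph removes the domain as a subtype, so that images can be handled by their
coordinates alone. -/
theorem commutatorBoundedBy_diagonalOperator_iff {a : H →L[ℂ] H} {K : ℝ} :
    CommutatorBoundedBy (diagonalOperator b ev) a K ↔
      ∀ ξ ζ, IsDiagonalImage b ev ξ ζ →
        ∃ ζ', IsDiagonalImage b ev (a ξ) ζ' ∧ ‖ζ' - a ζ‖ ≤ K * ‖ξ‖ := by
  constructor
  · intro h ξ ζ hξ
    obtain ⟨h', hb⟩ := h ⟨ξ, hξ.mem_domain⟩
    refine ⟨_, isDiagonalImage_apply ⟨a ξ, h'⟩, ?_⟩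
    rwa [hξ.apply_eq] at hb
  · intro h ξ
    obtain ⟨ζ', h1, h2⟩ := h ξ _ (isDiagonalImage_apply ξ)
    refine ⟨h1.mem_domain, ?_⟩
    rwa [h1.apply_eq]

/-- The operator is symmetric because its eigenvalues are real. -/
theorem IsDiagonalImage.inner_comm {ξ ζ ξ' ζ' : H} (h : IsDiagonalImage b ev ξ ζ)
    (h' : IsDiagonalImage b ev ξ' ζ') : inner ℂ ζ ξ' = inner ℂ ξ ζ' := by
  rw [← b.repr.inner_map_map, ← b.repr.inner_map_map ξ, lp.inner_eq_tsum, lp.inner_eq_tsum]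
  congr 1
  funext n
  rw [h n, h' n]
  simp only [RCLike.inner_apply, map_mul, Complex.conj_ofReal]
  ring

theorem dense_isDiagonalImage (b : HilbertBasis ι ℂ H) (ev : ι → ℝ) :
    Dense {ξ : H | ∃ ζ, IsDiagonalImage b ev ξ ζ} := by
  classical
  have h : ((Submodule.span ℂ (Set.range b) : Submodule ℂ H) : Set H) ⊆
      {ξ : H | ∃ ζ, IsDiagonalImage b ev ξ ζ} := by
    intro ξ hξ
    refine Submodule.span_induction (p := fun ξ _ => ∃ ζ, IsDiagonalImage b ev ξ ζ)
      ?_ ?_ ?_ ?_ hξ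
    · rintro _ ⟨m, rfl⟩
      refine ⟨(ev m : ℂ) • b m, fun n => ?_⟩
      rw [map_smul, b.repr_self, lp.coeFn_smul, Pi.smul_apply, smul_eq_mul]
      rcases eq_or_ne n m with rfl | hn
      · rfl
      · rw [lp.single_apply_ne (p := 2) m _ hn]; simp
    · exact ⟨0, fun n => by simp⟩
    · rintro x y _ _ ⟨x', hx⟩ ⟨y', hy⟩
      refine ⟨x' + y', fun n => ?_⟩
      simp only [map_add, lp.coeFn_add, Pi.add_apply, hx n, hy n, mul_add]
    · rintro c x _ ⟨x', hx⟩
      refine ⟨c • x', fun n => ?_⟩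
      simp only [map_smul, lp.coeFn_smul, Pi.smul_apply, hx n, smul_eq_mul]
      ring
  have hd : Dense ((Submodule.span ℂ (Set.range b) : Submodule ℂ H) : Set H) := by
    rw [Submodule.dense_iff_topologicalClosure_eq_top]
    exact b.dense_span
  exact hd.mono h

/-- `U` is the unitary group generated by the diagonal operator with eigenvalues `ev`. -/
def IsDiagonalGroup (b : HilbertBasis ι ℂ H) (ev : ι → ℝ) (U : ℝ → H →ₗᵢ[ℂ] H) : Prop :=
  ∀ t ξ n, b.repr (U t ξ) n = Complex.exp (((t * ev n : ℝ) : ℂ) * Complex.I) * b.repr ξ n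

variable {U : ℝ → H →ₗᵢ[ℂ] H}

theorem IsDiagonalGroup.zero (hU : IsDiagonalGroup b ev U) (ξ : H) : U 0 ξ = ξ :=
  hilbertBasis_ext b fun n => by rw [hU]; simp

theorem IsDiagonalGroup.add (hU : IsDiagonalGroup b ev U) (t u : ℝ) (ξ : H) :
    U (t + u) ξ = U t (U u ξ) :=
  hilbertBasis_ext b fun n => by
    rw [hU, hU, hU, ← mul_assoc, ← Complex.exp_add]; congr 2; push_cast; ring

theorem IsDiagonalGroup.isDiagonalImage (hU : IsDiagonalGroup b ev U) (t : ℝ) {ξ ζ : H}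
    (h : IsDiagonalImage b ev ξ ζ) : IsDiagonalImage b ev (U t ξ) (U t ζ) := fun n => by
  rw [hU, hU, h n]; ring

theorem hasDerivAt_exp_mul_I (c : ℝ) :
    HasDerivAt (fun t : ℝ => Complex.exp (((t * c : ℝ) : ℂ) * Complex.I)) (c * Complex.I) 0 := by
  have h : HasDerivAt (fun t : ℝ => ((t * c : ℝ) : ℂ) * Complex.I) (c * Complex.I) 0 := by
    have := ((hasDerivAt_id (0 : ℝ)).mul_const c).ofReal_comp.mul_const Complex.I
    simpa using this
  simpa using h.cexp

/-- Stone's theorem for diagonal operators: the group is differentiable on the domain. -/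
theorem IsDiagonalGroup.tendsto_slope (hU : IsDiagonalGroup b ev U) {ξ ζ : H}
    (h : IsDiagonalImage b ev ξ ζ) :
    Tendsto (fun t : ℝ => ((t : ℂ)⁻¹) • (U t ξ - ξ)) (𝓝[≠] 0) (𝓝 (Complex.I • ζ)) := by
  -- The error of the difference quotient of the `n`-th phase. It tends to `0` for each `n` and is
  -- at most `2 |ev n|`, so dominated convergence applies: `ev n` times the coordinate of `ξ` is the
  -- square summable coordinate of `ζ`.
  set e : ℝ → ι → ℂ := fun t n => ((t : ℂ)⁻¹) *
    (Complex.exp (((t * ev n : ℝ) : ℂ) * Complex.I) - 1) - ev n * Complex.I with he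
  have hcoef : ∀ (t : ℝ) n, b.repr (((t : ℂ)⁻¹) • (U t ξ - ξ) - Complex.I • ζ) n = e t n * b.repr ξ n := by
    intro t n
    simp only [map_sub, map_smul, lp.coeFn_sub, lp.coeFn_smul, Pi.sub_apply, Pi.smul_apply, hU t ξ n,
      h n, smul_eq_mul, he]
    ring
  have hbound : ∀ t n, t ≠ 0 → ‖e t n‖ ≤ 2 * |ev n| := by
    intro t n ht
    have h1 : ‖Complex.exp (((t * ev n : ℝ) : ℂ) * Complex.I) - 1‖ ≤ |t * ev n| := by
      have := Real.norm_exp_I_mul_ofReal_sub_one_le (x := t * ev n)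
      rwa [mul_comm Complex.I, Real.norm_eq_abs] at this
    have h2 : ‖((t : ℂ)⁻¹) * (Complex.exp (((t * ev n : ℝ) : ℂ) * Complex.I) - 1)‖ ≤ |ev n| := by
      rw [norm_mul, norm_inv, Complex.norm_real, Real.norm_eq_abs, inv_mul_le_iff₀ (abs_pos.2 ht),
        ← abs_mul]
      exact h1
    refine (norm_sub_le _ _).trans ?_
    have : ‖(ev n : ℂ) * Complex.I‖ = |ev n| := by simp
    rw [this]; linarith
  have hpt : ∀ n, Tendsto (fun t => e t n) (𝓝[≠] 0) (𝓝 0) := by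
    intro n
    have := (hasDerivAt_exp_mul_I (ev n)).tendsto_slope_zero
    have h2 := this.sub_const (ev n * Complex.I)
    simp only [sub_self] at h2
    refine h2.congr fun t => ?_
    simp [he]
  have hsum : Summable fun n => (2 * ‖b.repr ζ n‖) ^ 2 := by
    have := (lp.memℓp (b.repr ζ)).summable (by norm_num)
    simp only [ENNReal.toReal_ofNat, Real.rpow_ofNat] at this
    simpa only [mul_pow] using this.mul_left (2 ^ 2)
  have hnorm : ∀ t : ℝ, ‖((t : ℂ)⁻¹) • (U t ξ - ξ) - Complex.I • ζ‖ ^ 2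
      = ∑' n, ‖e t n * b.repr ξ n‖ ^ 2 := by
    intro t
    rw [← b.repr.norm_map]
    have := lp.norm_rpow_eq_tsum (p := 2) (by norm_num)
      (b.repr (((t : ℂ)⁻¹) • (U t ξ - ξ) - Complex.I • ζ))
    simp only [ENNReal.toReal_ofNat, Real.rpow_ofNat] at this
    simpa only [hcoef] using this
  have hlim : Tendsto (fun t : ℝ => ∑' n, ‖e t n * b.repr ξ n‖ ^ 2) (𝓝[≠] 0)
      (𝓝 (∑' _ : ι, (0 : ℝ))) := by
    refine tendsto_tsum_of_dominated_convergence hsum (fun n => ?_) ?_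
    · have := (((hpt n).mul_const (b.repr ξ n)).norm).pow 2
      simpa using this
    · filter_upwards [self_mem_nhdsWithin] with t ht n
      rw [norm_pow, norm_norm]
      refine pow_le_pow_left₀ (norm_nonneg _) ?_ 2
      rw [norm_mul, h n, norm_mul, Complex.norm_real, Real.norm_eq_abs, ← mul_assoc]
      exact mul_le_mul_of_nonneg_right (hbound t n ht) (norm_nonneg _)
  rw [tsum_zero] at hlim
  rw [tendsto_iff_norm_sub_tendsto_zero]
  have h3 := (Real.continuous_sqrt.tendsto 0).comp hlim
  simp only [Real.sqrt_zero] at h3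
  refine h3.congr fun t => ?_
  simp only [Function.comp]
  rw [← hnorm, Real.sqrt_sq (norm_nonneg _)]

theorem IsDiagonalGroup.hasDerivAt (hU : IsDiagonalGroup b ev U) {ξ ζ : H}
    (h : IsDiagonalImage b ev ξ ζ) (t : ℝ) :
    HasDerivAt (fun t => U t ξ) (Complex.I • U t ζ) t := by
  rw [hasDerivAt_iff_tendsto_slope_zero]
  have h1 := ((U t).continuous.tendsto _).comp (hU.tendsto_slope h)
  rw [LinearIsometry.map_smul] at h1
  refine h1.congr fun u => ?_
  simp only [Function.comp, LinearIsometry.map_smul, LinearIsometry.map_sub, ← hU.add]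
  rw [← Complex.ofReal_inv]
  rfl

theorem IsDiagonalGroup.surjective (hU : IsDiagonalGroup b ev U) (t : ℝ) :
    Function.Surjective (U t) := fun ξ => ⟨U (-t) ξ, by rw [← hU.add]; simp [hU.zero]⟩

/-- By continuity the bound extends to all `y`, and then `y = x` is a valid test vector. -/
theorem norm_le_of_dense_inner {s : Set H} (hs : Dense s) {x : H} {C : ℝ} (hC : 0 ≤ C)
    (h : ∀ y ∈ s, ‖inner ℂ y x‖ ≤ C * ‖y‖) : ‖x‖ ≤ C := by
  have hc : IsClosed {y : H | ‖inner ℂ y x‖ ≤ C * ‖y‖} :=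
    isClosed_le (by fun_prop) (by fun_prop)
  have h2 : ‖inner ℂ x x‖ ≤ C * ‖x‖ := hc.closure_subset_iff.2 (fun y hy => h y hy) (hs x)
  rw [inner_self_eq_norm_sq_to_K] at h2
  have h3 : ‖x‖ ^ 2 ≤ C * ‖x‖ := by simpa using h2
  rcases (norm_nonneg x).eq_or_lt with h0 | hp
  · rwa [← h0]
  · nlinarith

/-- A bounded commutator gives a bound for the commutators with the unitary group. -/
theorem IsDiagonalGroup.norm_commutator_le (hU : IsDiagonalGroup b ev U) {a : H →L[ℂ] H} {K : ℝ}
    (hK : 0 ≤ K) (h : CommutatorBoundedBy (diagonalOperator b ev) a K) (t : ℝ) (ξ : H) :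
    ‖a (U t ξ) - U t (a ξ)‖ ≤ K * |t| * ‖ξ‖ := by
  rw [commutatorBoundedBy_diagonalOperator_iff] at h
  -- The matrix coefficient `⟨U t η, a (U t ξ)⟩` has derivative `-i ⟨U t η, [D, a] U t ξ⟩`, since
  -- `D` is symmetric; the mean value inequality integrates the bound.
  have key : ∀ η ζη ξ ζξ, IsDiagonalImage b ev η ζη → IsDiagonalImage b ev ξ ζξ →
      ‖(inner ℂ (U t η) (a (U t ξ)) : ℂ) - inner ℂ η (a ξ)‖ ≤ K * ‖η‖ * ‖ξ‖ * |t| := by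
    intro η ζη ξ ζξ hη hξ
    have hd : ∀ τ, HasDerivAt (fun τ => (inner ℂ (U τ η) (a (U τ ξ)) : ℂ))
        (inner ℂ (U τ η) (a (Complex.I • U τ ζξ)) + inner ℂ (Complex.I • U τ ζη) (a (U τ ξ))) τ := by
      intro τ
      have h1 := hU.hasDerivAt hη τ
      have h2 := ((a.restrictScalars ℝ).hasFDerivAt (x := U τ ξ)).comp_hasDerivAt τ
        (hU.hasDerivAt hξ τ)
      exact h1.inner ℂ h2
    have hb : ∀ τ, ‖(inner ℂ (U τ η) (a (Complex.I • U τ ζξ)) : ℂ)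
        + inner ℂ (Complex.I • U τ ζη) (a (U τ ξ))‖ ≤ K * ‖η‖ * ‖ξ‖ := by
      intro τ
      obtain ⟨ζ', hζ', hn⟩ := h _ _ (hU.isDiagonalImage τ hξ)
      have e : (inner ℂ (U τ η) (a (Complex.I • U τ ζξ)) : ℂ)
        + inner ℂ (Complex.I • U τ ζη) (a (U τ ξ))
          = - (Complex.I * inner ℂ (U τ η) (ζ' - a (U τ ζξ))) := by
        rw [map_smul, inner_smul_right, inner_smul_left,
          (hU.isDiagonalImage τ hη).inner_comm hζ', inner_sub_right, Complex.conj_I]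
        ring
      rw [e, norm_neg, norm_mul, Complex.norm_I, one_mul]
      refine (norm_inner_le_norm _ _).trans ?_
      rw [(U τ).norm_map] at hn ⊢
      calc _ ≤ ‖η‖ * (K * ‖ξ‖) := mul_le_mul_of_nonneg_left hn (norm_nonneg _)
        _ = _ := by ring
    have := Convex.norm_image_sub_le_of_norm_hasDerivWithin_le (s := Set.univ) (x := 0) (y := t)
      (fun τ _ => (hd τ).hasDerivWithinAt) (fun τ _ => hb τ) convex_univ trivial trivial
    simpa [hU.zero] using this
  have key2 : ∀ ξ ζξ, IsDiagonalImage b ev ξ ζξ →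
      ‖a (U t ξ) - U t (a ξ)‖ ≤ K * |t| * ‖ξ‖ := by
    intro ξ ζξ hξ
    -- Testing against the vectors `U t η` turns `⟨U t η, U t (a ξ)⟩` into `⟨η, a ξ⟩`, which is the
    -- difference bounded in `key`.
    have hdense : Dense (U t '' {η : H | ∃ ζ, IsDiagonalImage b ev η ζ}) :=
      (hU.surjective t).denseRange.dense_image (U t).continuous (dense_isDiagonalImage b ev)
    refine norm_le_of_dense_inner hdense (by positivity) ?_
    rintro _ ⟨η, ⟨ζ, hη⟩, rfl⟩
    rw [inner_sub_right, (U t).inner_map_map, (U t).norm_map]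
    refine (key η ζ ξ ζξ hη hξ).trans_eq (by ring)
  have hc : IsClosed {ξ : H | ‖a (U t ξ) - U t (a ξ)‖ ≤ K * |t| * ‖ξ‖} := by
    have := (U t).continuous
    exact isClosed_le (by fun_prop) (by fun_prop)
  exact hc.closure_subset_iff.2 (fun ξ hξ => key2 ξ _ hξ.choose_spec) (dense_isDiagonalImage b ev ξ)

/-- Lipschitz bounds for the commutators with the unitary group bound the commutator with the
generator. -/
theorem IsDiagonalGroup.commutatorBoundedBy (hU : IsDiagonalGroup b ev U) {a : H →L[ℂ] H} {K : ℝ}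
    (hK : 0 ≤ K) (h : ∀ t ξ, ‖a (U t ξ) - U t (a ξ)‖ ≤ K * |t| * ‖ξ‖) :
    CommutatorBoundedBy (diagonalOperator b ev) a K := by
  rw [commutatorBoundedBy_diagonalOperator_iff]
  intro ξ ζ hξ
  set q : ℝ → H := fun t => ((t : ℂ)⁻¹) • (U t (a ξ) - a (U t ξ)) with hq
  have hqn : ∀ t, t ≠ 0 → ‖q t‖ ≤ K * ‖ξ‖ := by
    intro t ht
    rw [hq, norm_smul, norm_sub_rev, norm_inv, Complex.norm_real, Real.norm_eq_abs,
      inv_mul_le_iff₀ (abs_pos.2 ht)]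
    exact (h t ξ).trans_eq (by ring)
  -- The coordinates that `i [D, a] ξ` must have; that `a ξ` lies in the domain is not yet known and
  -- follows once `v` is shown to be square summable.
  set v : ι → ℂ := fun n => Complex.I * (ev n * b.repr (a ξ) n - b.repr (a ζ) n) with hv
  have hlim : ∀ n, Tendsto (fun t => b.repr (q t) n) (𝓝[≠] 0) (𝓝 (v n)) := by
    intro n
    have h1 := (hasDerivAt_exp_mul_I (ev n)).tendsto_slope_zero.mul_const (b.repr (a ξ) n)
    have h2 := (a.continuous.tendsto _).comp (hU.tendsto_slope hξ)
    have h3 : Tendsto (fun t : ℝ => (inner ℂ (b n) (a (((t : ℂ)⁻¹) • (U t ξ - ξ))) : ℂ)) (𝓝[≠] 0)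
        (𝓝 (inner ℂ (b n) (a (Complex.I • ζ)))) :=
      ((innerSL ℂ (b n)).continuous.tendsto _).comp h2
    have h4 := h1.sub h3
    have e : (ev n * Complex.I * b.repr (a ξ) n : ℂ) - inner ℂ (b n) (a (Complex.I • ζ)) = v n := by
      rw [← b.repr_apply_apply, map_smul, map_smul, lp.coeFn_smul, Pi.smul_apply, smul_eq_mul, hv]
      ring
    rw [e] at h4
    refine h4.congr fun t => ?_
    rw [← b.repr_apply_apply]
    simp only [hq, map_smul, map_sub, lp.coeFn_smul, lp.coeFn_sub, Pi.smul_apply, Pi.sub_apply,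
      smul_eq_mul, hU t (a ξ) n]
    simp
    ring
  -- A Fatou argument: finite partial sums are limits of partial sums for `q t`, whose norms are
  -- bounded uniformly in `t`.
  have hfin : ∀ s : Finset ι, ∑ n ∈ s, ‖v n‖ ^ 2 ≤ (K * ‖ξ‖) ^ 2 := by
    intro s
    have h1 : Tendsto (fun t => ∑ n ∈ s, ‖b.repr (q t) n‖ ^ 2) (𝓝[≠] 0) (𝓝 (∑ n ∈ s, ‖v n‖ ^ 2)) :=
      tendsto_finsetSum _ fun n _ => ((hlim n).norm.pow 2)
    refine le_of_tendsto h1 ?_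
    filter_upwards [self_mem_nhdsWithin] with t ht
    have h2 := lp.sum_rpow_le_norm_rpow (p := 2) (by norm_num) (b.repr (q t)) s
    simp only [ENNReal.toReal_ofNat, Real.rpow_ofNat, b.repr.norm_map] at h2
    exact h2.trans (pow_le_pow_left₀ (norm_nonneg _) (hqn t ht) 2)
  have hmem : Memℓp v 2 := by
    refine memℓp_gen' (C := (K * ‖ξ‖) ^ 2) fun s => ?_
    simpa using hfin s
  set V : lp (fun _ : ι => ℂ) 2 := ⟨v, hmem⟩ with hV
  have hVn : ‖V‖ ≤ K * ‖ξ‖ := by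
    refine lp.norm_le_of_forall_sum_le (by norm_num) (mul_nonneg hK (norm_nonneg _)) fun s => ?_
    simpa using hfin s
  refine ⟨-Complex.I • b.repr.symm V + a ζ, fun n => ?_, ?_⟩
  · simp only [map_add, map_smul, LinearIsometryEquiv.apply_symm_apply, lp.coeFn_add,
      lp.coeFn_smul, Pi.add_apply, Pi.smul_apply, smul_eq_mul]
    change -Complex.I * v n + _ = _
    rw [hv]
    linear_combination (-(ev n * b.repr (a ξ) n - b.repr (a ζ) n)) * Complex.I_mul_I
  · rw [add_sub_cancel_right, norm_smul, norm_neg, Complex.norm_I, one_mul,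
      LinearIsometryEquiv.norm_map]
    exact hVn

end Diagonal

/-! ### Commutators on direct sums -/

section DirectSum

variable {ι : Type*} {H : ι → Type*} [∀ i, NormedAddCommGroup (H i)]
  [∀ i, InnerProductSpace ℂ (H i)]

/-- Vectors supported in one summand give one direction. For the other, a common `K` makes the
componentwise commutators square summable. -/
theorem commutatorBoundedBy_directSumOperator_iff {D : ∀ i, H i →ₗ.[ℂ] H i}
    {a : ∀ i, H i →L[ℂ] H i} {M K : ℝ} (hM : 0 ≤ M) (ha : ∀ i, ‖a i‖ ≤ M) (hK : 0 ≤ K) :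
    CommutatorBoundedBy (directSumOperator D) (lp.mapCLM 2 a hM ha) K ↔
      ∀ i, CommutatorBoundedBy (D i) (a i) K := by
  classical
  constructor
  · intro h i ξ
    have hdom : lp.single 2 i (ξ : H i) ∈ (directSumOperator D).domain := by
      have h1 : ∀ j, (lp.single 2 i (ξ : H i) : lp H 2) j ∈ (D j).domain := by
        intro j
        rcases eq_or_ne j i with rfl | hj
        · rw [lp.single_apply_self]; exact ξ.2
        · rw [lp.single_apply_ne _ _ _ hj]; exact (D j).domain.zero_mem
      refine ⟨h1, ?_⟩
      convert lp.memℓp (lp.single 2 i (D i ξ)) with j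
      rcases eq_or_ne j i with rfl | hj
      · exact (congrArg (D j) (Subtype.ext (lp.single_apply_self 2 j (ξ : H j)))).trans
          (lp.single_apply_self 2 j (D j ξ)).symm
      · have : (⟨_, h1 j⟩ : (D j).domain) = 0 := Subtype.ext (lp.single_apply_ne 2 i (ξ : H i) hj)
        exact ((congrArg (D j) this).trans (D j).map_zero).trans
          (lp.single_apply_ne 2 i (D i ξ) hj).symm
    obtain ⟨h1, h2⟩ := h ⟨_, hdom⟩
    have e1 : (lp.mapCLM 2 a hM ha (lp.single 2 i (ξ : H i)) : lp H 2) i = a i ξ := by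
      change a i ((lp.single 2 i (ξ : H i) : lp H 2) i) = _
      rw [lp.single_apply_self]
    have e2 : (⟨_, hdom.1 i⟩ : (D i).domain) = ξ :=
      Subtype.ext (lp.single_apply_self 2 i (ξ : H i))
    have h3 : a i ξ ∈ (D i).domain := e1 ▸ h1.1 i
    refine ⟨h3, ?_⟩
    have h4 := (lp.norm_apply_le_norm (by norm_num) _ i).trans h2
    rw [lp.norm_single (by norm_num)] at h4
    refine le_trans (le_of_eq ?_) h4
    rw [lp.coeFn_sub, Pi.sub_apply]
    change _ = ‖D i ⟨_, h1.1 i⟩ - a i (D i ⟨_, hdom.1 i⟩)‖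
    rw [e2]
    congr 3
    exact Subtype.ext e1.symm
  · intro h ξ
    have hc : ∀ i, ∃ hi : a i ((ξ : lp H 2) i) ∈ (D i).domain,
        ‖D i ⟨a i ((ξ : lp H 2) i), hi⟩ - a i (D i ⟨_, ξ.2.1 i⟩)‖ ≤ K * ‖(ξ : lp H 2) i‖ :=
      fun i => h i ⟨_, ξ.2.1 i⟩
    choose h1 h2 using hc
    -- Square summability of `D (a ξ)`, which the domain requires, follows from writing it as `[D,
    -- a] ξ + a (D ξ)`.
    have hC : Memℓp (fun i => D i ⟨a i ((ξ : lp H 2) i), h1 i⟩ - a i (D i ⟨_, ξ.2.1 i⟩)) 2 := by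
      have hm : Memℓp (fun i => K * ‖(ξ : lp H 2) i‖) 2 := (lp.memℓp (ξ : lp H 2)).norm.const_mul K
      exact hm.mono' fun i => (h2 i).trans (le_abs_self _)
    have hdom : lp.mapCLM 2 a hM ha (ξ : lp H 2) ∈ (directSumOperator D).domain := by
      refine ⟨h1, ?_⟩
      have := hC.add (lp.memℓp (lp.mapCLM 2 a hM ha (directSumOperator D ξ)))
      convert this using 1
      funext i
      exact (sub_add_cancel _ _).symm
    refine ⟨hdom, ?_⟩
    refine lp.norm_le_of_forall_sum_le (by norm_num) (mul_nonneg hK (norm_nonneg _)) fun s => ?_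
    simp only [ENNReal.toReal_ofNat, Real.rpow_ofNat]
    have h3 := lp.sum_rpow_le_norm_rpow (p := 2) (by norm_num) (ξ : lp H 2) s
    simp only [ENNReal.toReal_ofNat, Real.rpow_ofNat] at h3
    calc _ ≤ ∑ i ∈ s, (K * ‖(ξ : lp H 2) i‖) ^ 2 :=
          Finset.sum_le_sum fun i _ => pow_le_pow_left₀ (norm_nonneg _) (h2 i) 2
      _ = K ^ 2 * ∑ i ∈ s, ‖(ξ : lp H 2) i‖ ^ 2 := by simp only [mul_pow, Finset.mul_sum]
      _ ≤ K ^ 2 * ‖(ξ : lp H 2)‖ ^ 2 := mul_le_mul_of_nonneg_left h3 (sq_nonneg K)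
      _ = _ := by rw [mul_pow]

end DirectSum

open MeasureTheory

/-! ### Translations and multiplication operators on the circle -/

section Circle

variable {T : ℝ} [Fact (0 < T)]

theorem measurePreserving_add_haarAddCircle (t : AddCircle T) :
    MeasurePreserving (fun q : AddCircle T => q + t) AddCircle.haarAddCircle
      AddCircle.haarAddCircle :=
  measurePreserving_add_right _ t

/-- The translation group of the circle, twisted by a phase so that its generator has the
eigenvalues `2π n / T + c`. -/
def twistedTranslation (T : ℝ) [Fact (0 < T)] (c t : ℝ) : CircleL2 T →ₗᵢ[ℂ] CircleL2 T where
  toLinearMap := Complex.exp (((t * c : ℝ) : ℂ) * Complex.I) •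
    (Lp.compMeasurePreservingₗᵢ ℂ _ (measurePreserving_add_haarAddCircle (t : AddCircle T))).toLinearMap
  norm_map' ξ := by
    rw [LinearMap.smul_apply, norm_smul, Complex.norm_exp_ofReal_mul_I, one_mul]
    exact LinearIsometry.norm_map _ ξ

theorem coeFn_twistedTranslation (c t : ℝ) (ξ : CircleL2 T) :
    twistedTranslation T c t ξ =ᵐ[AddCircle.haarAddCircle] fun q =>
      Complex.exp (((t * c : ℝ) : ℂ) * Complex.I) * ξ (q + (t : AddCircle T)) := by
  have h1 := Lp.coeFn_compMeasurePreserving ξ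
    (measurePreserving_add_haarAddCircle (t : AddCircle T))
  have h2 := Lp.coeFn_smul (Complex.exp (((t * c : ℝ) : ℂ) * Complex.I))
    (Lp.compMeasurePreserving _ (measurePreserving_add_haarAddCircle (t : AddCircle T)) ξ)
  filter_upwards [h1, h2] with q h1 h2
  change (Complex.exp (((t * c : ℝ) : ℂ) * Complex.I) •
    Lp.compMeasurePreserving _ (measurePreserving_add_haarAddCircle (t : AddCircle T)) ξ :
      CircleL2 T) q = _
  rw [h2, Pi.smul_apply, h1]
  rfl

theorem fourier_eval_add {T : ℝ} (n : ℤ) (x y : AddCircle T) :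
    fourier n (x + y) = fourier n x * fourier n y := by
  simp [fourier_apply, smul_add, AddCircle.toCircle_add]

theorem fourierCoeff_translate (f : AddCircle T → ℂ) (t : AddCircle T) (n : ℤ) :
    fourierCoeff (fun q => f (q + t)) n = fourier n t * fourierCoeff f n := by
  unfold fourierCoeff
  rw [← integral_const_mul,
    ← integral_add_right_eq_self (fun q => fourier n t * (fourier (-n) q • f q)) t]
  congr 1
  funext q
  rw [fourier_eval_add, smul_eq_mul, smul_eq_mul]
  have h : fourier n t * fourier (-n) t = 1 := by
    rw [← fourier_add, add_neg_cancel, fourier_zero]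
  linear_combination (-(fourier (-n) q * f (q + t))) * h

theorem coeFn_mulOperator (g : C(AddCircle T, ℂ)) (ξ : CircleL2 T) :
    mulOperator g ξ =ᵐ[AddCircle.haarAddCircle] fun q => g q * ξ q := by
  have h1 := (ContinuousLinearMap.mul ℂ ℂ).coeFn_holder (r := 2)
    (ContinuousMap.toLp ∞ (AddCircle.haarAddCircle (T := T)) ℂ g) ξ
  have h2 := ContinuousMap.coeFn_toLp (p := ∞) (𝕜 := ℂ) (AddCircle.haarAddCircle (T := T)) g
  filter_upwards [h1, h2] with q h1 h2
  change (ContinuousLinearMap.holder 2 (ContinuousLinearMap.mul ℂ ℂ) _ _ : CircleL2 T) q = _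
  rw [h1, h2]
  rfl

theorem norm_mulOperator_apply_le {g : C(AddCircle T, ℂ)} {C : ℝ} (hC : 0 ≤ C)
    (h : ∀ q, ‖g q‖ ≤ C) (ξ : CircleL2 T) : ‖mulOperator g ξ‖ ≤ C * ‖ξ‖ :=
  (mulOperator g).le_of_opNorm_le
    ((norm_mulOperator_le g).trans ((ContinuousMap.norm_le g hC).2 h)) ξ

/-- If `|g|` exceeded `C` somewhere, it would exceed some `C' > C` on a nonempty open set. That set
has positive Haar measure, and its indicator function contradicts the bound. -/
theorem norm_apply_le_of_norm_mulOperator_le {g : C(AddCircle T, ℂ)} {C : ℝ}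
    (h : ∀ ξ : CircleL2 T, ‖mulOperator g ξ‖ ≤ C * ‖ξ‖) (q : AddCircle T) : ‖g q‖ ≤ C := by
  by_contra! hq
  obtain ⟨C', hC, hC'⟩ := exists_between hq
  set E : Set (AddCircle T) := {q | C' < ‖g q‖} with hE
  have hEo : IsOpen E := isOpen_lt continuous_const (by fun_prop)
  have hpos : 0 < AddCircle.haarAddCircle E := hEo.measure_pos _ ⟨q, hC'⟩
  set χ : CircleL2 T := indicatorConstLp 2 hEo.measurableSet (measure_ne_top _ E) (1 : ℂ) with hχ
  have hχ0 : 0 < ‖χ‖ := by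
    rw [hχ, norm_indicatorConstLp (by norm_num) (by norm_num), norm_one, one_mul]
    exact Real.rpow_pos_of_pos (ENNReal.toReal_pos hpos.ne' (measure_ne_top _ E)) _
  have h0 : 0 ≤ C := by
    by_contra! h0
    have := (norm_nonneg _).trans (h χ)
    nlinarith
  have h1 : ‖(C' : ℂ) • χ‖ ≤ ‖mulOperator g χ‖ := by
    refine Lp.norm_le_norm_of_ae_le ?_
    filter_upwards [coeFn_mulOperator g χ, Lp.coeFn_smul (C' : ℂ) χ,
      indicatorConstLp_coeFn (p := 2) (hs := hEo.measurableSet) (hμs := measure_ne_top _ E)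
        (c := (1 : ℂ))] with q h1 h2 h3
    rw [h1, h2, Pi.smul_apply, norm_smul, norm_mul, hχ, h3]
    by_cases hqE : q ∈ E
    · rw [Set.indicator_of_mem hqE]
      refine mul_le_mul_of_nonneg_right ?_ (norm_nonneg _)
      rw [Complex.norm_real, Real.norm_eq_abs, abs_of_nonneg (by linarith)]
      exact le_of_lt hqE
    · rw [Set.indicator_of_notMem hqE]; simp
  rw [norm_smul, Complex.norm_real, Real.norm_eq_abs, abs_of_nonneg (by linarith)] at h1
  have := h1.trans (h χ)
  nlinarith

/-- Moving the translation past the multiplication replaces `g` by its translate, and the scalar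
phase commutes with everything. -/
theorem mulOperator_commutator (g : C(AddCircle T, ℂ)) (c t : ℝ) (ξ : CircleL2 T) :
    mulOperator g (twistedTranslation T c t ξ) - twistedTranslation T c t (mulOperator g ξ)
      = mulOperator (g - g.comp (ContinuousMap.addRight (t : AddCircle T)))
        (twistedTranslation T c t ξ) := by
  refine Lp.ext ?_
  have h5 := (measurePreserving_add_haarAddCircle (t : AddCircle T)).quasiMeasurePreserving.ae_eq_comp
    (coeFn_mulOperator g ξ)
  simp only [Function.comp_def] at h5
  filter_upwards [Lp.coeFn_sub (mulOperator g (twistedTranslation T c t ξ))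
      (twistedTranslation T c t (mulOperator g ξ)),
    coeFn_mulOperator g (twistedTranslation T c t ξ), coeFn_twistedTranslation c t ξ,
    coeFn_twistedTranslation c t (mulOperator g ξ), h5,
    coeFn_mulOperator (g - g.comp (ContinuousMap.addRight (t : AddCircle T)))
      (twistedTranslation T c t ξ)] with q h1 h2 h3 h4 h5 h6
  rw [h1, Pi.sub_apply, h2, h4, h5, h6, h3]
  simp only [ContinuousMap.sub_apply, ContinuousMap.comp_apply, ContinuousMap.coe_addRight]
  ring

end Circle

/-- As the circumference is `2π r`, translation by `t` multiplies the `k`-th character by `exp (i k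
t / r)`; the phase `exp (i t / (2r))` supplies the shift by `1/2`. -/
theorem Summand.isDiagonalGroup (s : Summand) :
    IsDiagonalGroup (fourierBasis (T := s.perimeter))
      (fun k : ℤ => ((k : ℝ) + 1 / 2) / s.radius)
      (twistedTranslation s.perimeter (1 / (2 * s.radius))) := by
  intro t ξ n
  rw [fourierBasis_repr, fourierBasis_repr,
    fourierCoeff_congr_ae (coeFn_twistedTranslation _ t ξ), fourierCoeff.const_mul,
    fourierCoeff_translate, ← mul_assoc, fourier_coe_apply, ← Complex.exp_add]
  congr 2
  have := s.radius_pos.ne'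
  have : (s.radius : ℂ) ≠ 0 := by exact_mod_cast this
  have hpi : (Real.pi : ℂ) ≠ 0 := by exact_mod_cast Real.pi_ne_zero
  simp only [Summand.perimeter]
  push_cast
  field_simp
  ring

/-- The commutator with the Dirac operator of a triangle is bounded by `1` if and only if the
restriction of the function to the triangle is `1`-Lipschitz with respect to arc length. -/
theorem Summand.commutatorBoundedBy_iff (s : Summand) (f : C(gasket, ℂ)) :
    CommutatorBoundedBy s.dirac (s.rep f) 1 ↔
      ∀ (t : ℝ) (q : AddCircle s.perimeter),
        ‖f (s.loop q) - f (s.loop (q + (t : AddCircle s.perimeter)))‖ ≤ |t| := by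
  have hU := s.isDiagonalGroup
  constructor
  · intro h t
    have h1 := fun ξ => hU.norm_commutator_le zero_le_one h t ξ
    refine norm_apply_le_of_norm_mulOperator_le
      (g := f.comp s.loop - (f.comp s.loop).comp (ContinuousMap.addRight (t : AddCircle s.perimeter)))
      fun ξ => ?_
    obtain ⟨ξ, rfl⟩ := hU.surjective t ξ
    rw [← mulOperator_commutator, LinearIsometry.norm_map]
    exact (h1 ξ).trans_eq (by rw [one_mul])
  · intro h
    refine hU.commutatorBoundedBy zero_le_one fun t ξ => ?_
    refine (congrArg norm (mulOperator_commutator (f.comp s.loop) _ t ξ)).trans_le ?_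
    rw [one_mul, ← (twistedTranslation s.perimeter (1 / (2 * s.radius)) t).norm_map ξ]
    exact norm_mulOperator_apply_le (abs_nonneg t) (fun q => h t q) _

theorem commutatorBoundedBy_sumDirac_iff (J : Set Summand) (f : C(gasket, ℂ)) :
    CommutatorBoundedBy (sumDirac J) (sumRep J f) 1 ↔
      ∀ s ∈ J, ∀ (t : ℝ) (q : AddCircle s.perimeter),
        ‖f (s.loop q) - f (s.loop (q + (t : AddCircle s.perimeter)))‖ ≤ |t| := by
  refine (commutatorBoundedBy_directSumOperator_iff (norm_nonneg f) (fun s : J => s.1.norm_rep_le f)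
    zero_le_one).trans ?_
  simp only [Summand.commutatorBoundedBy_iff, Subtype.forall]

/-! ### Barycentric coordinates -/

/-- The length of the edges of the outer triangle. -/
def side : ℝ := 2 * Real.pi / 3

theorem side_pos : 0 < side := by unfold side; positivity

/-- The barycentric coordinates with respect to the corners of the outer triangle. -/
def bary : Fin 3 → ℂ → ℝ :=
  ![fun z => 1 - z.re / side - z.im / (Real.sqrt 3 * side),
    fun z => z.re / side - z.im / (Real.sqrt 3 * side),
    fun z => 2 * (z.im / (Real.sqrt 3 * side))]

theorem bary_sum (z : ℂ) : bary 0 z + bary 1 z + bary 2 z = 1 := by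
  simp only [bary, Matrix.cons_val]
  ring

theorem continuous_bary (i : Fin 3) : Continuous (bary i) := by
  fin_cases i <;> simp only [bary, Fin.zero_eta, Fin.mk_one, Fin.reduceFinMk, Matrix.cons_val] <;>
    fun_prop

theorem corner_eq : corner = ![0, ⟨side, 0⟩, ⟨side / 2, Real.sqrt 3 * side / 2⟩] := by
  have h1 : side = 2 * Real.pi / 3 := rfl
  have h2 : side / 2 = Real.pi / 3 := by rw [h1]; ring
  have h3 : Real.sqrt 3 * side / 2 = Real.sqrt 3 * Real.pi / 3 := by rw [h1]; ring
  rw [h2, h3, h1]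
  rfl

theorem bary_corner (i j : Fin 3) : bary i (corner j) = if i = j then 1 else 0 := by
  have := side_pos.ne'
  have h3 : Real.sqrt 3 ≠ 0 := by positivity
  rw [corner_eq]
  fin_cases i <;> fin_cases j <;> simp [bary] <;> try field_simp
  all_goals first | exact this | norm_num

theorem bary_contraction (i j : Fin 3) (z : ℂ) :
    bary j (contraction i z) = (bary j z + if j = i then 1 else 0) / 2 := by
  rw [← bary_corner]
  fin_cases j <;> simp [bary, contraction] <;> ring

theorem dist_sq_eq (x y : ℂ) : dist x y ^ 2 = side ^ 2 * ((bary 0 x - bary 0 y) ^ 2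
    + (bary 0 x - bary 0 y) * (bary 1 x - bary 1 y) + (bary 1 x - bary 1 y) ^ 2) := by
  have := side_pos.ne'
  have h3 : Real.sqrt 3 ≠ 0 := by positivity
  have h3' : Real.sqrt 3 ^ 2 = 3 := Real.sq_sqrt (by norm_num)
  rw [dist_eq_norm, ← Complex.normSq_eq_norm_sq, Complex.normSq_apply]
  simp only [bary, Matrix.cons_val, Complex.sub_re, Complex.sub_im]
  field_simp
  ring_nf
  rw [h3']
  ring

/-- A coordinate runs from `0` to `1` across an altitude, so `2 / (√3 side)` would be sharp; the
cruder constant avoids the root. -/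
theorem abs_bary_sub_le (i : Fin 3) (x y : ℂ) :
    |bary i x - bary i y| ≤ 2 / side * dist x y := by
  have hs := side_pos
  have h := dist_sq_eq x y
  have h1 := bary_sum x
  have h2 := bary_sum y
  have h3 : (side * (bary i x - bary i y)) ^ 2 ≤ (2 * dist x y) ^ 2 := by
    rw [mul_pow 2, h, mul_pow]
    have e2 : bary 2 x - bary 2 y = -(bary 0 x - bary 0 y) - (bary 1 x - bary 1 y) := by linarith
    generalize e0 : bary 0 x - bary 0 y = d0 at *
    generalize e1 : bary 1 x - bary 1 y = d1 at *
    have : (bary i x - bary i y) ^ 2 ≤ 4 * (d0 ^ 2 + d0 * d1 + d1 ^ 2) := by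
      fin_cases i <;> simp only [Fin.zero_eta, Fin.mk_one, Fin.reduceFinMk, e0, e1, e2]
      · nlinarith [sq_nonneg (d0 + 2 * d1), sq_nonneg d0]
      · nlinarith [sq_nonneg (2 * d0 + d1), sq_nonneg d1]
      · nlinarith [sq_nonneg (d0 - d1), sq_nonneg (d0 + d1)]
    nlinarith [sq_nonneg side]
  have h4 := abs_le_of_sq_le_sq h3 (by positivity)
  rw [div_mul_eq_mul_div, le_div_iff₀ hs]
  rw [abs_mul, abs_of_pos hs] at h4
  linarith

theorem eq_of_bary_eq {x y : ℂ} (h0 : bary 0 x = bary 0 y) (h1 : bary 1 x = bary 1 y) : x = y := by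
  have := dist_sq_eq x y
  rw [h0, h1] at this
  simpa using this

/-- On a line parallel to an edge, the distance is measured by the other coordinates. -/
theorem dist_eq_of_bary_eq {k j : Fin 3} (hjk : j ≠ k) {x y : ℂ} (h : bary k x = bary k y) :
    dist x y = side * |bary j x - bary j y| := by
  have hs := side_pos
  have h1 := bary_sum x
  have h2 := bary_sum y
  rw [← abs_of_pos hs, ← abs_mul, ← Real.sqrt_sq_eq_abs, ← Real.sqrt_sq (dist_nonneg (x := x) (y := y)),
    dist_sq_eq]
  congr 1
  have e2 : bary 2 x - bary 2 y = -(bary 0 x - bary 0 y) - (bary 1 x - bary 1 y) := by linarith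
  have hk : bary k x - bary k y = 0 := by linarith
  generalize e0 : bary 0 x - bary 0 y = d0 at *
  generalize e1 : bary 1 x - bary 1 y = d1 at *
  fin_cases k <;> fin_cases j <;> simp at hjk hk ⊢ <;>
    simp only [e0, e1, e2] at hk ⊢
  · subst hk; ring
  · subst hk; ring
  · subst hk; ring
  · subst hk; ring
  · obtain rfl : d1 = -d0 := by linarith
    ring
  · obtain rfl : d0 = -d1 := by linarith
    ring

theorem dist_contraction (i : Fin 3) (x y : ℂ) :
    dist (contraction i x) (contraction i y) = dist x y / 2 := by
  rw [dist_eq_norm, dist_eq_norm, contraction, contraction, ← sub_div, add_sub_add_right_eq_sub,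
    norm_div, Complex.norm_ofNat]

theorem continuous_contraction (i : Fin 3) : Continuous (contraction i) := by
  unfold contraction; fun_prop

theorem contraction_corner_comm (i j : Fin 3) :
    contraction i (corner j) = contraction j (corner i) := by
  rw [contraction, contraction, add_comm]

theorem contraction_corner_self (i : Fin 3) : contraction i (corner i) = corner i := by
  rw [contraction]; ring

theorem contraction_injective (i : Fin 3) : Function.Injective (contraction i) := by
  intro x y h
  simpa [contraction] using h

theorem contraction_lineMap (i : Fin 3) (x y : ℂ) (t : ℝ) :
    contraction i (AffineMap.lineMap x y t)
      = AffineMap.lineMap (contraction i x) (contraction i y) t := by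
  simp only [AffineMap.lineMap_apply_module, contraction, Complex.real_smul]
  push_cast
  ring

theorem image_contraction_segment (i : Fin 3) (x y : ℂ) :
    contraction i '' segment ℝ x y = segment ℝ (contraction i x) (contraction i y) := by
  simp only [segment_eq_image_lineMap, Set.image_image, contraction_lineMap]

theorem bary_lineMap (i : Fin 3) (x y : ℂ) (t : ℝ) :
    bary i (AffineMap.lineMap x y t) = (1 - t) * bary i x + t * bary i y := by
  fin_cases i <;> simp [bary, AffineMap.lineMap_apply_module] <;> ring

/-! ### Self-similarity of the gasket -/

theorem image_contraction_triangleEdges (i : Fin 3) (v : Fin 3 → ℂ) :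
    contraction i '' triangleEdges v = triangleEdges fun k => contraction i (v k) := by
  simp only [triangleEdges, Set.image_union, image_contraction_segment]

theorem cellVertices_cons (i : Fin 3) (w : List (Fin 3)) :
    cellVertices (i :: w) = fun k => contraction i (cellVertices w k) := rfl

theorem contraction_mem_gasket (i : Fin 3) {z : ℂ} (hz : z ∈ gasket) : contraction i z ∈ gasket := by
  have h1 : contraction i '' gasket ⊆ closure (contraction i '' ⋃ w, triangleEdges (cellVertices w)) :=
    image_closure_subset_closure_image (continuous_contraction i)
  refine closure_mono ?_ (h1 ⟨z, hz, rfl⟩)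
  rw [Set.image_iUnion]
  refine Set.iUnion_subset fun w => ?_
  rw [image_contraction_triangleEdges, ← cellVertices_cons]
  exact Set.subset_iUnion (fun w => triangleEdges (cellVertices w)) (i :: w)

theorem segment_corner_subset (i j : Fin 3) : segment ℝ (corner i) (corner j) ⊆ gasket := by
  have h : triangleEdges corner ⊆ gasket :=
    Set.Subset.trans (Set.subset_iUnion (fun w => triangleEdges (cellVertices w)) []) subset_closure
  have h01 : segment ℝ (corner 0) (corner 1) ⊆ gasket := fun z hz => h (Or.inl (Or.inl hz))
  have h12 : segment ℝ (corner 1) (corner 2) ⊆ gasket := fun z hz => h (Or.inl (Or.inr hz))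
  have h20 : segment ℝ (corner 2) (corner 0) ⊆ gasket := fun z hz => h (Or.inr hz)
  have hd : ∀ i, segment ℝ (corner i) (corner i) ⊆ gasket := by
    intro i
    rw [segment_same, Set.singleton_subset_iff]
    fin_cases i
    · exact h01 (left_mem_segment _ _ _)
    · exact h12 (left_mem_segment _ _ _)
    · exact h20 (left_mem_segment _ _ _)
  fin_cases i <;> fin_cases j <;> simp only [Fin.zero_eta, Fin.mk_one, Fin.reduceFinMk]
  all_goals first
    | exact hd _
    | assumption
    | (rw [segment_symm]; assumption)

theorem corner_mem_gasket (i : Fin 3) : corner i ∈ gasket :=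
  segment_corner_subset i i (left_mem_segment _ _ _)

/-- Each half of an edge is the image of the whole edge under the contraction towards its end. -/
theorem segment_corner_subset_iUnion (i j : Fin 3) :
    segment ℝ (corner i) (corner j) ⊆ ⋃ k, contraction k '' gasket := by
  rw [segment_eq_image_lineMap]
  rintro _ ⟨t, ⟨h0, h1⟩, rfl⟩
  have hm : ∀ u : ℝ, 0 ≤ u → u ≤ 1 → AffineMap.lineMap (corner i) (corner j) u ∈ gasket :=
    fun u hu0 hu1 => segment_corner_subset i j
      (by rw [segment_eq_image_lineMap]; exact ⟨u, ⟨hu0, hu1⟩, rfl⟩)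
  rcases le_total t (1 / 2) with h | h
  · refine Set.mem_iUnion.2 ⟨i, _, hm (2 * t) (by linarith) (by linarith), ?_⟩
    simp only [AffineMap.lineMap_apply_module, contraction, Complex.real_smul]
    push_cast
    ring
  · refine Set.mem_iUnion.2 ⟨j, _, hm (2 * t - 1) (by linarith) (by linarith), ?_⟩
    simp only [AffineMap.lineMap_apply_module, contraction, Complex.real_smul]
    push_cast
    ring

/-- The right side is closed, so it suffices to cover the edges of all triangles: those of a
nonempty word lie in the cell of its first letter, and those of the outer triangle split into
halves. -/
theorem gasket_subset_iUnion : gasket ⊆ ⋃ i, contraction i '' gasket := by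
  have hcl : IsClosed (⋃ i, contraction i '' gasket) :=
    isClosed_iUnion_of_finite fun i =>
      (gasket_isCompact.image (continuous_contraction i)).isClosed
  refine closure_minimal (Set.iUnion_subset fun w => ?_) hcl
  cases w with
  | nil =>
    exact Set.union_subset (Set.union_subset (segment_corner_subset_iUnion 0 1)
      (segment_corner_subset_iUnion 1 2)) (segment_corner_subset_iUnion 2 0)
  | cons i w =>
    rw [cellVertices_cons, ← image_contraction_triangleEdges]
    refine Set.subset_iUnion_of_subset i (Set.image_mono ?_)
    exact Set.Subset.trans (Set.subset_iUnion (fun w => triangleEdges (cellVertices w)) w)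
      subset_closure

theorem bary_nonneg_of_mem {z : ℂ} (hz : z ∈ gasket) (i : Fin 3) : 0 ≤ bary i z := by
  have hcl : IsClosed {z : ℂ | 0 ≤ bary i z} := isClosed_le continuous_const (continuous_bary i)
  refine closure_minimal (Set.iUnion_subset fun w => ?_) hcl hz
  have hv : ∀ k, 0 ≤ bary i (cellVertices w k) := by
    intro k
    induction w with
    | nil =>
      change 0 ≤ bary i (corner k)
      rw [bary_corner]; split_ifs <;> norm_num
    | cons j w ih =>
      rw [cellVertices_cons, bary_contraction]; split_ifs <;> linarith
  have hs : ∀ k l, segment ℝ (cellVertices w k) (cellVertices w l) ⊆ {z : ℂ | 0 ≤ bary i z} := by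
    intro k l
    rw [segment_eq_image_lineMap]
    rintro _ ⟨t, ⟨h0, h1⟩, rfl⟩
    rw [Set.mem_ofPred_eq, bary_lineMap]
    have := hv k
    have := hv l
    have : 0 ≤ 1 - t := by linarith
    positivity
  exact Set.union_subset (Set.union_subset (hs 0 1) (hs 1 2)) (hs 2 0)

/-- The contraction towards the `i`-th corner, as a map of the gasket. -/
def cell (i : Fin 3) : C(gasket, gasket) where
  toFun x := ⟨contraction i x, contraction_mem_gasket i x.2⟩
  continuous_toFun := ((continuous_contraction i).comp continuous_subtype_val).subtype_mk _

theorem coe_cell (i : Fin 3) (x : gasket) : (cell i x : ℂ) = contraction i x := rfl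

/-- The corners, as points of the gasket. -/
def vertex (i : Fin 3) : gasket := ⟨corner i, corner_mem_gasket i⟩

/-- The barycentric coordinates, as functions on the gasket. -/
def coord (i : Fin 3) : C(gasket, ℝ) where
  toFun x := bary i x
  continuous_toFun := (continuous_bary i).comp continuous_subtype_val

theorem coord_cell (i j : Fin 3) (x : gasket) :
    coord j (cell i x) = (coord j x + if j = i then 1 else 0) / 2 := bary_contraction i j x

theorem coord_vertex (i j : Fin 3) : coord i (vertex j) = if i = j then 1 else 0 := bary_corner i j

theorem coord_nonneg (i : Fin 3) (x : gasket) : 0 ≤ coord i x := bary_nonneg_of_mem x.2 i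

theorem coord_sum (x : gasket) : coord 0 x + coord 1 x + coord 2 x = 1 := bary_sum x

theorem coord_add_le_one {i j : Fin 3} (h : i ≠ j) (x : gasket) : coord i x + coord j x ≤ 1 := by
  have := coord_sum x
  have h0 := coord_nonneg 0 x
  have h1 := coord_nonneg 1 x
  have h2 := coord_nonneg 2 x
  fin_cases i <;> fin_cases j <;> simp at h ⊢ <;> linarith

theorem coord_le_one (i : Fin 3) (x : gasket) : coord i x ≤ 1 := by
  have h := coord_add_le_one (i := i) (j := i + 1) (by fin_cases i <;> decide) x
  linarith [coord_nonneg (i + 1) x]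

theorem coord_ext {x y : gasket} (h0 : coord 0 x = coord 0 y) (h1 : coord 1 x = coord 1 y) : x = y :=
  Subtype.ext (eq_of_bary_eq h0 h1)

theorem eq_vertex_of_coord_eq_one {i : Fin 3} {x : gasket} (h : coord i x = 1) : x = vertex i := by
  have hz : ∀ j, coord j x = if j = i then 1 else 0 := by
    intro j
    split_ifs with hj
    · rw [hj, h]
    · have := coord_add_le_one hj x
      linarith [coord_nonneg j x]
  exact coord_ext (by rw [hz, coord_vertex]) (by rw [hz, coord_vertex])

theorem exists_cell_eq (x : gasket) : ∃ i y, cell i y = x := by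
  obtain ⟨i, y, hy, h⟩ := Set.mem_iUnion.1 (gasket_subset_iUnion x.2)
  exact ⟨i, ⟨y, hy⟩, Subtype.ext h⟩

theorem cell_injective (i : Fin 3) : Function.Injective (cell i) := fun _ _ h =>
  Subtype.ext (contraction_injective i (congrArg Subtype.val h))

theorem cell_vertex_comm (i j : Fin 3) : cell i (vertex j) = cell j (vertex i) :=
  Subtype.ext (contraction_corner_comm i j)

theorem cell_vertex_self (i : Fin 3) : cell i (vertex i) = vertex i :=
  Subtype.ext (contraction_corner_self i)

/-- Two different cells meet only in their common vertex. -/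
theorem eq_vertex_of_cell_eq {i j : Fin 3} (hij : i ≠ j) {x y : gasket} (h : cell i x = cell j y) :
    x = vertex j ∧ y = vertex i := by
  have h1 := congrArg (coord j) h
  have h2 := congrArg (coord i) h
  simp only [coord_cell, if_neg hij, if_neg hij.symm, if_true] at h1 h2
  have := coord_le_one j x
  have := coord_le_one i y
  have := coord_nonneg j y
  have := coord_nonneg i x
  exact ⟨eq_vertex_of_coord_eq_one (by linarith), eq_vertex_of_coord_eq_one (by linarith)⟩

theorem dist_cell (i : Fin 3) (x y : gasket) : dist (cell i x) (cell i y) = dist x y / 2 :=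
  dist_contraction i x y

/-- The similarity of the gasket belonging to a word. -/
def wordCell (w : List (Fin 3)) (x : gasket) : gasket := w.foldr (fun i y => cell i y) x

@[simp] theorem wordCell_nil (x : gasket) : wordCell [] x = x := rfl

@[simp] theorem wordCell_cons (i : Fin 3) (w : List (Fin 3)) (x : gasket) :
    wordCell (i :: w) x = cell i (wordCell w x) := rfl

theorem wordCell_append_singleton (w : List (Fin 3)) (i : Fin 3) (x : gasket) :
    wordCell (w ++ [i]) x = wordCell w (cell i x) := by
  simp [wordCell]

theorem coe_wordCell (w : List (Fin 3)) (x : gasket) : (wordCell w x : ℂ) = wordMap w x := by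
  induction w with
  | nil => rfl
  | cons i w ih => rw [wordCell_cons, coe_cell, ih]; rfl

theorem dist_wordCell (w : List (Fin 3)) (x y : gasket) :
    dist (wordCell w x) (wordCell w y) = (1 / 2) ^ w.length * dist x y := by
  induction w with
  | nil => simp
  | cons i w ih => rw [wordCell_cons, wordCell_cons, dist_cell, ih, List.length_cons, pow_succ]; ring

theorem segment_wordMap_subset {a b : ℂ} (h : segment ℝ a b ⊆ gasket) (w : List (Fin 3)) :
    segment ℝ (wordMap w a) (wordMap w b) ⊆ gasket := by
  induction w with
  | nil => exact h
  | cons i w ih =>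
    simp only [wordMap]
    rw [← image_contraction_segment]
    rintro _ ⟨z, hz, rfl⟩
    exact contraction_mem_gasket i (ih hz)

theorem dist_le_two_mul_side (x y : gasket) : dist x y ≤ 2 * side := by
  have hs := side_pos
  refine abs_le_of_sq_le_sq' (a := dist x y) ?_ (by positivity) |>.2
  rw [Subtype.dist_eq, dist_sq_eq, mul_pow, mul_comm]
  refine mul_le_mul_of_nonneg_right ?_ (by positivity)
  have h0 := coord_nonneg 0 x
  have h1 := coord_nonneg 1 x
  have h0' := coord_le_one 0 x
  have h1' := coord_le_one 1 x
  have h2 := coord_nonneg 0 y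
  have h3 := coord_nonneg 1 y
  have h2' := coord_le_one 0 y
  have h3' := coord_le_one 1 y
  change (coord 0 x - coord 0 y) ^ 2 + (coord 0 x - coord 0 y) * (coord 1 x - coord 1 y)
    + (coord 1 x - coord 1 y) ^ 2 ≤ _
  have a1 : |coord 0 x - coord 0 y| ≤ 1 := abs_le.2 ⟨by linarith, by linarith⟩
  have a2 : |coord 1 x - coord 1 y| ≤ 1 := abs_le.2 ⟨by linarith, by linarith⟩
  have a3 := abs_le.1 ((abs_mul _ _).trans_le (mul_le_one₀ a1 (abs_nonneg _) a2))
  have a4 := (sq_le_one_iff_abs_le_one _).2 a1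
  have a5 := (sq_le_one_iff_abs_le_one _).2 a2
  linarith [a3.2]

/-! ### Distances that scale with the cells are dominated by the Euclidean distance -/

section Scaling

variable {d : gasket → gasket → ℝ≥0∞} {M : ℝ}

/-- The cells at corner `i` shrink to it, and the last of them containing `x` has size comparable to
`1 - coord i x`. The induction descends through them: `1 - coord i` doubles as long as `x` stays in
the corner cell, and once it has left, `1 - coord i x ≥ 1/2` and the oscillation bound is enough. -/
theorem dist_wordCell_vertex_le (hself : ∀ x, d x x = 0)
    (hosc : ∀ w x y, d (wordCell w x) (wordCell w y) ≤ ENNReal.ofReal (M * (1 / 2) ^ w.length))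
    (hM : 0 ≤ M) (w : List (Fin 3)) (i : Fin 3) (x : gasket) :
    d (wordCell w x) (wordCell w (vertex i))
      ≤ ENNReal.ofReal (2 * M * (1 / 2) ^ w.length * (1 - coord i x)) := by
  have key : ∀ (k : ℕ) (w : List (Fin 3)) (x : gasket), (1 / 2 : ℝ) ^ k ≤ 1 - coord i x →
      d (wordCell w x) (wordCell w (vertex i))
        ≤ ENNReal.ofReal (2 * M * (1 / 2) ^ w.length * (1 - coord i x)) := by
    intro k
    induction k with
    | zero =>
      intro w x hx
      refine (hosc w _ _).trans (ENNReal.ofReal_le_ofReal ?_)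
      have : 0 ≤ M * (1 / 2) ^ w.length := by positivity
      rw [pow_zero] at hx
      nlinarith
    | succ k ih =>
      intro w x hx
      obtain ⟨j, y, rfl⟩ := exists_cell_eq x
      rw [coord_cell] at hx ⊢
      by_cases hij : i = j
      · subst hij
        rw [if_pos rfl] at hx ⊢
        have h1 := ih (w ++ [i]) y (by rw [pow_succ] at hx; linarith)
        rw [wordCell_append_singleton, wordCell_append_singleton, cell_vertex_self,
          List.length_append, List.length_singleton] at h1
        refine h1.trans (le_of_eq ?_)
        congr 1
        rw [pow_succ]; ring
      · rw [if_neg hij]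
        refine (hosc w _ _).trans (ENNReal.ofReal_le_ofReal ?_)
        have : 0 ≤ M * (1 / 2) ^ w.length := by positivity
        have := coord_le_one i y
        nlinarith
  rcases (coord_le_one i x).eq_or_lt with h | h
  · rw [eq_vertex_of_coord_eq_one h, hself]
    exact zero_le
  · obtain ⟨k, hk⟩ := exists_pow_lt_of_lt_one (sub_pos.2 h) (by norm_num : (1 / 2 : ℝ) < 1)
    exact key k w x hk.le

/-- The path goes through the common vertex of the two cells. Its length is governed by `1 - coord j
x` and `1 - coord i y`, and both are controlled by the Euclidean distance, as the coordinates `i`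
and `j` separate the cells at `1/2`. -/
theorem dist_cell_cell_le (hself : ∀ x, d x x = 0) (hsymm : ∀ x y, d x y ≤ d y x)
    (htri : ∀ x y z, d x z ≤ d x y + d y z)
    (hosc : ∀ w x y, d (wordCell w x) (wordCell w y) ≤ ENNReal.ofReal (M * (1 / 2) ^ w.length))
    (hM : 0 ≤ M) (w : List (Fin 3)) {i j : Fin 3} (hij : i ≠ j) (x y : gasket) :
    d (wordCell w (cell i x)) (wordCell w (cell j y)) ≤ ENNReal.ofReal
      (8 / side * M * (1 / 2) ^ w.length * dist (cell i x) (cell j y)) := by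
  have h1 := dist_wordCell_vertex_le hself hosc hM (w ++ [i]) j x
  have h2 := (hsymm _ _).trans (dist_wordCell_vertex_le hself hosc hM (w ++ [j]) i y)
  rw [wordCell_append_singleton, wordCell_append_singleton, List.length_append,
    List.length_singleton] at h1 h2
  rw [cell_vertex_comm j i] at h2
  refine (htri _ _ _).trans ((add_le_add h1 h2).trans ?_)
  have := coord_le_one j x
  have := coord_le_one i y
  rw [← ENNReal.ofReal_add (mul_nonneg (by positivity) (by linarith))
    (mul_nonneg (by positivity) (by linarith))]
  refine ENNReal.ofReal_le_ofReal ?_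
  have h3 := (le_abs_self _).trans (abs_bary_sub_le i (cell i x) (cell j y))
  have h4 := (neg_le_abs _).trans (abs_bary_sub_le j (cell i x) (cell j y))
  change coord i (cell i x) - coord i (cell j y) ≤ 2 / side * dist (cell i x) (cell j y) at h3
  change -(coord j (cell i x) - coord j (cell j y)) ≤ 2 / side * dist (cell i x) (cell j y) at h4
  simp only [coord_cell, if_neg hij, if_neg hij.symm, if_true] at h3 h4
  have h5 := coord_nonneg i x
  have h6 := coord_nonneg j y
  have h7 : (1 - coord j x) + (1 - coord i y) ≤ 4 * (2 / side * dist (cell i x) (cell j y)) := by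
    linarith
  have h8 : 0 ≤ M * (1 / 2) ^ w.length := by positivity
  have h9 := mul_le_mul_of_nonneg_left h7 h8
  calc _ = M * (1 / 2) ^ w.length * ((1 - coord j x) + (1 - coord i y)) := by rw [pow_succ]; ring
    _ ≤ _ := h9
    _ = _ := by ring

/-- A pseudo-distance for which the cells of level `n` have diameter `O(2⁻ⁿ)` is dominated by the
Euclidean distance. -/
theorem le_const_mul_dist (hself : ∀ x, d x x = 0) (hsymm : ∀ x y, d x y ≤ d y x)
    (htri : ∀ x y z, d x z ≤ d x y + d y z)
    (hosc : ∀ w x y, d (wordCell w x) (wordCell w y) ≤ ENNReal.ofReal (M * (1 / 2) ^ w.length))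
    (hM : 0 ≤ M) (x y : gasket) : d x y ≤ ENNReal.ofReal (8 / side * M * dist x y) := by
  have hs := side_pos
  -- Passing to a common cell doubles the distance, so `k` bounds the number of levels until the
  -- points separate; the factor `3` exceeds the diameter bound `2 * side` and makes `k = 0`
  -- vacuous.
  have key : ∀ (k : ℕ) (w : List (Fin 3)) (x y : gasket), 3 * side * (1 / 2 : ℝ) ^ k ≤ dist x y →
      d (wordCell w x) (wordCell w y)
        ≤ ENNReal.ofReal (8 / side * M * (1 / 2) ^ w.length * dist x y) := by
    intro k
    induction k with
    | zero =>
      intro w x y h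
      have := dist_le_two_mul_side x y
      rw [pow_zero] at h
      linarith
    | succ k ih =>
      intro w x y h
      obtain ⟨i, x, rfl⟩ := exists_cell_eq x
      obtain ⟨j, y, rfl⟩ := exists_cell_eq y
      by_cases hij : i = j
      · subst hij
        rw [dist_cell] at h ⊢
        have h1 := ih (w ++ [i]) x y (by rw [pow_succ] at h; linarith)
        rw [wordCell_append_singleton, wordCell_append_singleton, List.length_append,
          List.length_singleton] at h1
        refine h1.trans (le_of_eq ?_)
        congr 1
        rw [pow_succ]; ring
      · exact dist_cell_cell_le hself hsymm htri hosc hM w hij x y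
  rcases eq_or_ne x y with rfl | hxy
  · rw [hself]; exact zero_le
  · have hp : 0 < dist x y / (3 * side) := div_pos (dist_pos.2 hxy) (by linarith)
    obtain ⟨k, hk⟩ := exists_pow_lt_of_lt_one hp (by norm_num : (1 / 2 : ℝ) < 1)
    have := key k [] x y (by rw [lt_div_iff₀ (by linarith)] at hk; linarith)
    simpa using this

end Scaling

/-! ### The geodesic distance -/

theorem geodesicDist_self (x : gasket) : geodesicDist x x = 0 := by
  refine le_antisymm (iInf_le_of_le (Path.refl x) ?_) zero_le
  exact (eVariationOn.constant_on (Set.subsingleton_of_subset_singleton (a := x)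
    (by rintro _ ⟨t, _, rfl⟩; rfl))).le

theorem geodesicDist_comm_le (x y : gasket) : geodesicDist x y ≤ geodesicDist y x :=
  le_iInf fun γ => iInf_le_of_le γ.symm
    (eVariationOn.comp_le_of_antitoneOn γ unitInterval.symm
      (fun a _ b _ hab => by
        simpa using hab) (Set.mapsTo_univ _ _))

theorem eVariationOn_trans_le {x y z : gasket} (γ : Path x y) (γ' : Path y z) :
    eVariationOn (γ.trans γ' : unitInterval → gasket) Set.univ
      ≤ eVariationOn (γ : unitInterval → gasket) Set.univ
        + eVariationOn (γ' : unitInterval → gasket) Set.univ := by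
  set h : unitInterval := ⟨1 / 2, by norm_num, by norm_num⟩ with hh
  have e : (Set.univ : Set unitInterval) = Set.Iic h ∪ Set.Ici h := Set.Iic_union_Ici.symm
  conv_lhs => rw [e]
  rw [eVariationOn.union _ isGreatest_Iic isLeast_Ici]
  refine add_le_add ?_ ?_
  · have : Set.EqOn (γ.trans γ' : unitInterval → gasket)
        (γ ∘ fun t : unitInterval => Set.projIcc 0 1 zero_le_one (2 * (t : ℝ))) (Set.Iic h) := by
      intro t ht
      have ht' : (t : ℝ) ≤ 1 / 2 := ht
      rw [Path.trans_apply, dif_pos ht', Function.comp,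
        Set.projIcc_of_mem zero_le_one ⟨by linarith [t.2.1], by linarith⟩]
    rw [eVariationOn.congr this]
    refine eVariationOn.comp_le_of_monotoneOn _ _ ?_ (Set.mapsTo_univ _ _)
    intro a _ b _ hab
    have : (a : ℝ) ≤ b := hab
    exact Set.monotone_projIcc _ (by linarith)
  · have : Set.EqOn (γ.trans γ' : unitInterval → gasket)
        (γ' ∘ fun t : unitInterval => Set.projIcc 0 1 zero_le_one (2 * (t : ℝ) - 1)) (Set.Ici h) := by
      intro t ht
      have ht' : 1 / 2 ≤ (t : ℝ) := ht
      rw [Path.trans_apply, Function.comp,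
        Set.projIcc_of_mem zero_le_one ⟨by linarith, by linarith [t.2.2]⟩]
      split_ifs with h2
      · have : (t : ℝ) = 1 / 2 := le_antisymm h2 ht'
        simp [this]
      · rfl
    rw [eVariationOn.congr this]
    refine eVariationOn.comp_le_of_monotoneOn _ _ ?_ (Set.mapsTo_univ _ _)
    intro a _ b _ hab
    have : (a : ℝ) ≤ b := hab
    exact Set.monotone_projIcc _ (by linarith)

theorem geodesicDist_triangle (x y z : gasket) :
    geodesicDist x z ≤ geodesicDist x y + geodesicDist y z := by
  conv_rhs => unfold geodesicDist
  rw [ENNReal.iInf_add]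
  refine le_iInf fun γ => ?_
  rw [ENNReal.add_iInf]
  exact le_iInf fun γ' => iInf_le_of_le (γ.trans γ') (eVariationOn_trans_le γ γ')

theorem edist_le_geodesicDist (x y : gasket) : edist x y ≤ geodesicDist x y :=
  le_iInf fun γ => by
    have := eVariationOn.edist_le (γ : unitInterval → gasket) (Set.mem_univ 0) (Set.mem_univ 1)
    rwa [γ.source, γ.target] at this

/-- It serves to compare a curve with a monotone real function, whose variation is known. -/
theorem eVariationOn_le_of_edist_le {α E F : Type*} [LinearOrder α] [PseudoEMetricSpace E]
    [PseudoEMetricSpace F] {f : α → E} {g : α → F} {s : Set α}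
    (h : ∀ x y, x ≤ y → edist (f y) (f x) ≤ edist (g y) (g x)) :
    eVariationOn f s ≤ eVariationOn g s := by
  refine iSup_le fun p => ?_
  exact (Finset.sum_le_sum fun i _ => h _ _ (p.2.2.1 (Nat.le_succ i))).trans
    (eVariationOn.sum_le p.2.2.1 p.2.2.2)

/-- The function that increases linearly from `0` to `1` on `[1 - 2⁻ⁿ, 1 - 2⁻ⁿ⁻¹]`. -/
def ramp (n : ℕ) (t : ℝ) : ℝ := max 0 (min 1 (2 ^ (n + 1) * (t - 1) + 2))

theorem ramp_nonneg (n : ℕ) (t : ℝ) : 0 ≤ ramp n t := le_max_left _ _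

theorem ramp_le_one (n : ℕ) (t : ℝ) : ramp n t ≤ 1 := max_le zero_le_one (min_le_left _ _)

theorem ramp_mono (n : ℕ) : Monotone (ramp n) := by
  intro s t h
  unfold ramp
  gcongr

theorem continuous_ramp (n : ℕ) : Continuous (ramp n) := by unfold ramp; fun_prop

theorem ramp_zero (n : ℕ) : ramp n 0 = 0 := by
  have : (1 : ℝ) ≤ 2 ^ n := one_le_pow₀ (by norm_num)
  unfold ramp
  rw [max_eq_left]
  refine (min_le_right _ _).trans ?_
  rw [pow_succ]; linarith

theorem ramp_one (n : ℕ) : ramp n 1 = 1 := by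
  unfold ramp; norm_num

/-- The ramps rise one after another: while one is rising, all earlier ones are complete. -/
theorem ramp_eq_one_of_lt {n m : ℕ} (h : n < m) {t : ℝ} (ht : ramp m t ≠ 0) : ramp n t = 1 := by
  have h1 : 0 < 2 ^ (m + 1) * (t - 1) + 2 := by
    by_contra! h2
    exact ht (max_eq_left ((min_le_right _ _).trans h2))
  have h2 : 1 ≤ 2 ^ (n + 1) * (t - 1) + 2 := by
    rcases le_or_gt 1 t with h3 | h3
    · have : 0 ≤ 2 ^ (n + 1) * (t - 1) := mul_nonneg (by positivity) (by linarith)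
      linarith
    · have h4 : (2 : ℝ) ^ (n + 1) * 2 ≤ 2 ^ (m + 1) := by
        rw [← pow_succ]; exact pow_le_pow_right₀ (by norm_num) (by omega)
      nlinarith
  unfold ramp
  rw [min_eq_left h2, max_eq_right zero_le_one]

/-- The length of an infinite polygon bounds the geodesic distance of its endpoints. -/
theorem geodesicDist_le_tsum {v : ℕ → gasket} {x : gasket}
    (hseg : ∀ n, segment ℝ (v n : ℂ) (v (n + 1)) ⊆ gasket)
    (hsum : Summable fun n => dist (v n) (v (n + 1))) (hlim : Tendsto v atTop (𝓝 x)) :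
    geodesicDist (v 0) x ≤ ENNReal.ofReal (∑' n, dist (v n) (v (n + 1))) := by
  set δ : ℕ → ℂ := fun n => (v (n + 1) : ℂ) - v n with hδ
  have hδn : ∀ n, ‖δ n‖ = dist (v n) (v (n + 1)) := fun n => by
    rw [dist_comm, Subtype.dist_eq, dist_eq_norm]
  have hb : ∀ n t, ‖(ramp n t : ℂ) * δ n‖ ≤ dist (v n) (v (n + 1)) := by
    intro n t
    rw [norm_mul, hδn, Complex.norm_real, Real.norm_eq_abs, abs_of_nonneg (ramp_nonneg n t)]
    exact mul_le_of_le_one_left dist_nonneg (ramp_le_one n t)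
  have hS : ∀ t, Summable fun n => (ramp n t : ℂ) * δ n := fun t =>
    Summable.of_norm_bounded hsum fun n => hb n t
  -- The polygon, written as a uniformly convergent series in which the `n`-th ramp traverses the
  -- `n`-th edge; this gives continuity also at the limit point `t = 1`.
  set γ : ℝ → ℂ := fun t => v 0 + ∑' n, (ramp n t : ℂ) * δ n with hγ
  have hγc : Continuous γ := by
    refine continuous_const.add (continuous_tsum (fun n => ?_) hsum hb)
    have := continuous_ramp n
    fun_prop
  have htel : ∀ N, (v 0 : ℂ) + ∑ n ∈ Finset.range N, δ n = v N := by
    intro N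
    rw [Finset.sum_range_sub (fun n => (v n : ℂ))]; ring
  have hγ0 : γ 0 = v 0 := by simp [hγ, ramp_zero]
  have hγ1 : γ 1 = x := by
    have h1 : Tendsto (fun N => (v 0 : ℂ) + ∑ n ∈ Finset.range N, (ramp n 1 : ℂ) * δ n) atTop
        (𝓝 (γ 1)) := (hS 1).hasSum.tendsto_sum_nat.const_add _
    refine tendsto_nhds_unique h1 ?_
    simp only [ramp_one, Complex.ofReal_one, one_mul, htel]
    exact (continuous_subtype_val.tendsto x).comp hlim
  have hγK : ∀ t, γ t ∈ gasket := by
    intro t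
    have hcl : IsClosed gasket := isClosed_closure
    have h1 : Tendsto (fun N => (v 0 : ℂ) + ∑ n ∈ Finset.range N, (ramp n t : ℂ) * δ n) atTop
        (𝓝 (γ t)) := (hS t).hasSum.tendsto_sum_nat.const_add _
    refine hcl.mem_of_tendsto h1 (Eventually.of_forall fun N => ?_)
    induction N with
    | zero => simp
    | succ N ih =>
      rw [Finset.sum_range_succ, ← add_assoc]
      -- Either edge `N` has not been started, or all earlier edges are complete, so that the sum
      -- telescopes to a point on edge `N`.
      by_cases h0 : ramp N t = 0
      · simpa [h0] using ih
      · have h2 : ∑ n ∈ Finset.range N, (ramp n t : ℂ) * δ n = ∑ n ∈ Finset.range N, δ n :=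
          Finset.sum_congr rfl fun n hn => by
            rw [ramp_eq_one_of_lt (Finset.mem_range.1 hn) h0]; simp
        rw [h2, htel]
        apply hseg N
        rw [segment_eq_image']
        exact ⟨ramp N t, ⟨ramp_nonneg N t, ramp_le_one N t⟩, by simp [hδ]⟩
  -- The length travelled up to time `t`. It is monotone and its increments bound those of `γ`.
  set G : ℝ → ℝ := fun t => ∑' n, ramp n t * dist (v n) (v (n + 1)) with hG
  have hGS : ∀ t, Summable fun n => ramp n t * dist (v n) (v (n + 1)) := fun t =>
    Summable.of_nonneg_of_le (fun n => mul_nonneg (ramp_nonneg n t) dist_nonneg)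
      (fun n => mul_le_of_le_one_left dist_nonneg (ramp_le_one n t)) hsum
  have hGm : Monotone G := fun s t hst => Summable.tsum_le_tsum
    (fun n => mul_le_mul_of_nonneg_right (ramp_mono n hst) dist_nonneg) (hGS s) (hGS t)
  have hγG : ∀ s t, s ≤ t → dist (γ t) (γ s) ≤ dist (G t) (G s) := by
    intro s t hst
    have e1 : γ t - γ s = ∑' n, ((ramp n t - ramp n s : ℝ) : ℂ) * δ n := by
      rw [hγ]
      simp only [add_sub_add_left_eq_sub]
      rw [← (hS t).tsum_sub (hS s)]
      congr 1; funext n; push_cast; ring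
    have e2 : G t - G s = ∑' n, (ramp n t - ramp n s) * dist (v n) (v (n + 1)) := by
      rw [hG, ← (hGS t).tsum_sub (hGS s)]
      congr 1; funext n; ring
    rw [Real.dist_eq, abs_of_nonneg (sub_nonneg.2 (hGm hst)), dist_eq_norm, e1, e2]
    have e3 : ∀ n, ‖((ramp n t - ramp n s : ℝ) : ℂ) * δ n‖
        = (ramp n t - ramp n s) * dist (v n) (v (n + 1)) := by
      intro n
      rw [norm_mul, hδn, Complex.norm_real, Real.norm_eq_abs,
        abs_of_nonneg (sub_nonneg.2 (ramp_mono n hst))]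
    have e4 : Summable fun n => ‖((ramp n t - ramp n s : ℝ) : ℂ) * δ n‖ := by
      simp only [e3, sub_mul]
      exact (hGS t).sub (hGS s)
    exact (norm_tsum_le_tsum_norm e4).trans_eq (tsum_congr e3)
  let Γ : Path (v 0) x :=
    { toFun := fun t => ⟨γ t, hγK t⟩
      continuous_toFun := (hγc.comp continuous_subtype_val).subtype_mk _
      source' := Subtype.ext hγ0
      target' := Subtype.ext hγ1 }
  refine (iInf_le _ Γ).trans ?_
  have h1 : eVariationOn (Γ : unitInterval → gasket) Set.univ
      ≤ eVariationOn (fun t : unitInterval => G t) Set.univ := by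
    refine eVariationOn_le_of_edist_le fun s t hst => ?_
    rw [edist_dist, edist_dist]
    exact ENNReal.ofReal_le_ofReal (hγG s t hst)
  refine h1.trans ?_
  have h2 := MonotoneOn.eVariationOn_eq (f := fun t : unitInterval => G t) (s := Set.univ)
    (fun s _ t _ hst => hGm hst) (a := 0) (b := 1) trivial trivial
  have e : Set.univ ∩ Set.Icc (0 : unitInterval) 1 = Set.univ := by
    rw [Set.univ_inter]
    exact Set.eq_univ_of_forall fun t => ⟨unitInterval.nonneg t, unitInterval.le_one t⟩
  rw [e] at h2
  refine h2.le.trans_eq ?_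
  simp [hG, ramp_zero, ramp_one]

/-- The polygon with a single edge, constant from then on. -/
theorem geodesicDist_le_of_segment_subset {x y : gasket} (h : segment ℝ (x : ℂ) y ⊆ gasket) :
    geodesicDist x y ≤ ENNReal.ofReal (dist x y) := by
  set v : ℕ → gasket := fun n => if n = 0 then x else y with hv
  have h0 : ∀ n, n ≠ 0 → dist (v n) (v (n + 1)) = 0 := fun n hn => by simp [hv, hn]
  have hlim : Tendsto v atTop (𝓝 y) := tendsto_const_nhds.congr' (by
    filter_upwards [eventually_ne_atTop 0] with n hn
    simp [hv, hn])
  have := geodesicDist_le_tsum (v := v) (x := y) ?_ (summable_of_ne_finset_zero (s := {0})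
    fun n hn => h0 n (by simpa using hn)) hlim
  · rw [tsum_eq_single 0 h0] at this
    simpa [hv] using this
  · intro n
    rcases eq_or_ne n 0 with rfl | hn
    · simpa [hv] using h
    · simp [hv, hn, segment_same]

/-- Every point is the intersection of a nested sequence of cells. -/
theorem exists_itinerary (x : gasket) :
    ∃ (i : ℕ → Fin 3) (y : ℕ → gasket), y 0 = x ∧ ∀ n, cell (i n) (y (n + 1)) = y n := by
  choose i g hg using exists_cell_eq
  refine ⟨fun n => i (g^[n] x), fun n => g^[n] x, rfl, fun n => ?_⟩
  simp only [Function.iterate_succ_apply', hg]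

/-- The polygon visits the corners `0` of the nested cells containing the point. Consecutive corners
are joined by half of an edge of a cell or coincide, and the crude bounds `2 * side * 2⁻ⁿ`, relative
to the cell of `w`, sum to `4 * side`. -/
theorem geodesicDist_wordCell_vertex_le (w : List (Fin 3)) (x : gasket) :
    geodesicDist (wordCell w (vertex 0)) (wordCell w x)
      ≤ ENNReal.ofReal (4 * side * (1 / 2) ^ w.length) := by
  have hs := side_pos
  obtain ⟨i, y, hy0, hy⟩ := exists_itinerary x
  set W : ℕ → List (Fin 3) := fun n => Nat.rec w (fun n W => W ++ [i n]) n with hW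
  have hW0 : W 0 = w := rfl
  have hWs : ∀ n, W (n + 1) = W n ++ [i n] := fun n => rfl
  have hWl : ∀ n, (W n).length = w.length + n := by
    intro n
    induction n with
    | zero => rfl
    | succ n ih => rw [hWs, List.length_append, ih, List.length_singleton, add_assoc]
  have hWy : ∀ n, wordCell (W n) (y n) = wordCell w x := by
    intro n
    induction n with
    | zero => rw [hW0, hy0]
    | succ n ih => rw [hWs, wordCell_append_singleton, hy, ih]
  set v : ℕ → gasket := fun n => wordCell (W n) (vertex 0) with hv
  have hlim : Tendsto v atTop (𝓝 (wordCell w x)) := by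
    rw [tendsto_iff_dist_tendsto_zero]
    have hb : ∀ n, dist (v n) (wordCell w x) ≤ 2 * side * (1 / 2) ^ n := by
      intro n
      rw [← hWy n, dist_wordCell, hWl, mul_comm]
      refine mul_le_mul (dist_le_two_mul_side _ _) ?_ (by positivity) (by positivity)
      exact pow_le_pow_of_le_one (by norm_num) (by norm_num) (by omega)
    refine squeeze_zero (fun n => dist_nonneg) hb ?_
    have := (tendsto_pow_atTop_nhds_zero_of_lt_one (by norm_num) (by norm_num : (1 / 2 : ℝ) < 1))
    simpa using this.const_mul (2 * side)
  have hd : ∀ n, dist (v n) (v (n + 1)) ≤ 2 * side * (1 / 2) ^ w.length * (1 / 2) ^ n := by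
    intro n
    simp only [hv, hWs]
    rw [wordCell_append_singleton, dist_wordCell, hWl, pow_add]
    have := mul_le_mul_of_nonneg_left (dist_le_two_mul_side (vertex 0) (cell (i n) (vertex 0)))
      (by positivity : (0 : ℝ) ≤ (1 / 2) ^ w.length * (1 / 2) ^ n)
    linarith
  have hgeo := (summable_geometric_two).mul_left (2 * side * (1 / 2) ^ w.length)
  have hsum : Summable fun n => dist (v n) (v (n + 1)) :=
    Summable.of_nonneg_of_le (fun n => dist_nonneg) hd hgeo
  refine (geodesicDist_le_tsum (v := v) (fun n => ?_) hsum hlim).trans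
    (ENNReal.ofReal_le_ofReal ?_)
  · simp only [hv, hWs]
    rw [wordCell_append_singleton, coe_wordCell, coe_wordCell]
    refine segment_wordMap_subset ?_ _
    refine Set.Subset.trans ?_ (segment_corner_subset 0 (i n))
    refine (convex_segment _ _).segment_subset (left_mem_segment _ _ _) ?_
    rw [segment_eq_image_lineMap]
    refine ⟨1 / 2, ⟨by norm_num, by norm_num⟩, ?_⟩
    rw [coe_cell]
    simp only [vertex, contraction, AffineMap.lineMap_apply_module, Complex.real_smul]
    push_cast
    ring
  · refine (hsum.tsum_le_tsum hd hgeo).trans_eq ?_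
    rw [tsum_mul_left, tsum_geometric_two]; ring

theorem geodesicDist_le (x y : gasket) :
    geodesicDist x y ≤ ENNReal.ofReal (8 / side * (8 * side) * dist x y) := by
  have hs := side_pos
  refine le_const_mul_dist geodesicDist_self geodesicDist_comm_le geodesicDist_triangle
    (fun w x y => ?_) (by positivity) x y
  refine (geodesicDist_triangle _ (wordCell w (vertex 0)) _).trans ((add_le_add
    ((geodesicDist_comm_le _ _).trans (geodesicDist_wordCell_vertex_le w x))
    (geodesicDist_wordCell_vertex_le w y)).trans_eq ?_)
  rw [← ENNReal.ofReal_add (by positivity) (by positivity)]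
  congr 1; ring

/-! ### Arc length Lipschitz functions on triangles -/

/-- `f` is `1`-Lipschitz with respect to arc length on the circle parametrizing the triangle `s`. -/
def ArcLipschitz (s : Summand) (f : gasket → ℂ) : Prop :=
  ∀ (t : ℝ) (q : AddCircle s.perimeter),
    ‖f (s.loop q) - f (s.loop (q + (t : AddCircle s.perimeter)))‖ ≤ |t|

theorem coe_loop_of_mem_Icc (s : Summand) {t : ℝ} (ht : t ∈ Set.Icc 0 s.perimeter) :
    (s.loop (t : AddCircle s.perimeter) : ℂ) = triangleParam s.vertices s.perimeter t := by
  change AddCircle.liftIco s.perimeter 0 (triangleParam s.vertices s.perimeter) t = _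
  rcases ht.2.lt_or_eq with h | h
  · exact AddCircle.liftIco_coe_apply ⟨ht.1, by rwa [zero_add]⟩
  · have h1 : ((t : ℝ) : AddCircle s.perimeter) = ((0 : ℝ) : AddCircle s.perimeter) := by
      rw [h, AddCircle.coe_period]; rfl
    rw [h1, h, ← triangleParam_closed _ s.perimeter_pos.out]
    exact AddCircle.liftIco_coe_apply ⟨le_rfl, by simpa using s.perimeter_pos.out⟩

theorem exists_triangleParam_eq {v : Fin 3 → ℂ} {T : ℝ} (hT : 0 < T) {z : ℂ}
    (hz : z ∈ triangleEdges v) : ∃ t ∈ Set.Icc 0 T, triangleParam v T t = z := by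
  have hc := triangleParam_closed v hT
  rcases hz with (hz | hz) | hz <;> rw [segment_eq_image_lineMap] at hz <;>
    obtain ⟨u, ⟨h0, h1⟩, rfl⟩ := hz
  · refine ⟨u * T / 3, ⟨by positivity, by nlinarith⟩, ?_⟩
    rw [triangleParam, if_pos (by nlinarith)]
    congr 1; field_simp
  · rcases h0.eq_or_lt with rfl | h0
    · refine ⟨T / 3, ⟨by positivity, by linarith⟩, ?_⟩
      rw [triangleParam, if_pos le_rfl, show 3 * (T / 3) / T = 1 by field_simp]
      simp
    · refine ⟨(u + 1) * T / 3, ⟨by positivity, by nlinarith⟩, ?_⟩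
      rw [triangleParam, if_neg (by nlinarith), if_pos (by nlinarith)]
      congr 1; field_simp; ring
  · rcases h0.eq_or_lt with rfl | h0
    · refine ⟨2 * T / 3, ⟨by positivity, by linarith⟩, ?_⟩
      rw [triangleParam, if_neg (by linarith), if_pos le_rfl,
        show 3 * (2 * T / 3) / T - 1 = 1 by field_simp; norm_num]
      simp
    · refine ⟨(u + 2) * T / 3, ⟨by positivity, by nlinarith⟩, ?_⟩
      rw [triangleParam, if_neg (by nlinarith), if_neg (by nlinarith)]
      congr 1; field_simp; ring

/-- Two parameters in one period differ by at most the circumference; the sharper bound by one half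
of it is not needed. -/
theorem ArcLipschitz.norm_sub_le_perimeter {s : Summand} {f : gasket → ℂ} (h : ArcLipschitz s f)
    {p q : gasket} (hp : (p : ℂ) ∈ triangleEdges s.vertices)
    (hq : (q : ℂ) ∈ triangleEdges s.vertices) : ‖f p - f q‖ ≤ s.perimeter := by
  obtain ⟨a, ha, hpa⟩ := exists_triangleParam_eq s.perimeter_pos.out hp
  obtain ⟨b, hb, hqb⟩ := exists_triangleParam_eq s.perimeter_pos.out hq
  obtain rfl : s.loop (a : AddCircle s.perimeter) = p :=
    Subtype.ext ((coe_loop_of_mem_Icc s ha).trans hpa)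
  obtain rfl : s.loop (b : AddCircle s.perimeter) = q :=
    Subtype.ext ((coe_loop_of_mem_Icc s hb).trans hqb)
  have := h (b - a) a
  rw [← AddCircle.coe_add, add_sub_cancel] at this
  exact this.trans (abs_le.2 ⟨by linarith [ha.2, hb.1], by linarith [ha.1, hb.2]⟩)

/-- A function that is `1`-Lipschitz on each interval of a grid is `1`-Lipschitz. -/
theorem norm_sub_le_of_grid {E : Type*} [SeminormedAddCommGroup E] {F : ℝ → E} {δ : ℝ} (hδ : 0 < δ)
    (h : ∀ (m : ℤ) (a b : ℝ), m * δ ≤ a → a ≤ b → b ≤ (m + 1) * δ → ‖F a - F b‖ ≤ b - a)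
    {a b : ℝ} (hab : a ≤ b) : ‖F a - F b‖ ≤ b - a := by
  have ha1 : (⌊a / δ⌋ : ℝ) * δ ≤ a := by
    rw [← le_div_iff₀ hδ]; exact Int.floor_le _
  have ha2 : a ≤ ((⌊a / δ⌋ : ℝ) + 1) * δ := by
    rw [← div_le_iff₀ hδ]; exact (Int.lt_floor_add_one _).le
  have key : ∀ (n : ℕ) (b : ℝ), a ≤ b → b ≤ ((⌊a / δ⌋ : ℝ) + 1 + n) * δ → ‖F a - F b‖ ≤ b - a := by
    intro n
    induction n with
    | zero =>
      intro b hab hb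
      exact h ⌊a / δ⌋ a b ha1 hab (by simpa using hb)
    | succ n ih =>
      intro b hab hb
      rcases le_total b (((⌊a / δ⌋ : ℝ) + 1 + n) * δ) with hc | hc
      · exact ih b hab hc
      · have hac : a ≤ ((⌊a / δ⌋ : ℝ) + 1 + n) * δ :=
          ha2.trans (mul_le_mul_of_nonneg_right (by linarith [n.cast_nonneg (α := ℝ)]) hδ.le)
        have h1 := ih _ hac le_rfl
        have h2 := h (⌊a / δ⌋ + 1 + n) _ b (by push_cast; exact le_rfl) hc
          (by push_cast at hb ⊢; linarith)
        have := norm_sub_le_norm_sub_add_norm_sub (F a) (F (((⌊a / δ⌋ : ℝ) + 1 + n) * δ)) (F b)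
        linarith
  obtain ⟨n, hn⟩ := exists_nat_ge (b / δ - ((⌊a / δ⌋ : ℝ) + 1))
  exact key n b hab (by rw [← div_le_iff₀ hδ]; linarith)

theorem triangleParam_of_mem {v : Fin 3 → ℂ} {T : ℝ} (hT : 0 < T) (r : Fin 3) {t : ℝ}
    (h0 : (r : ℝ) * (T / 3) ≤ t) (h1 : t ≤ ((r : ℝ) + 1) * (T / 3)) :
    triangleParam v T t = AffineMap.lineMap (v r) (v (r + 1)) (3 * t / T - r) := by
  fin_cases r
  · simp only [Fin.zero_eta, Nat.cast_zero, zero_add, one_mul, sub_zero] at h1 ⊢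
    rw [triangleParam, if_pos h1]
  · simp only [Fin.mk_one, Nat.cast_one, one_mul] at h0 h1 ⊢
    rw [triangleParam]
    rcases h0.eq_or_lt with rfl | h0
    · rw [if_pos le_rfl, show 3 * (T / 3) / T = 1 by field_simp]; simp
    · rw [if_neg (by linarith), if_pos (by linarith)]; rfl
  · simp only [Fin.reduceFinMk, Nat.cast_ofNat] at h0 h1 ⊢
    rw [triangleParam, if_neg (by linarith)]
    rcases h0.eq_or_lt with rfl | h0
    · rw [if_pos (by linarith), show 3 * (2 * (T / 3)) / T - 1 = 1 by field_simp; norm_num,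
        show 3 * (2 * (T / 3)) / T - 2 = 0 by field_simp; norm_num]
      simp
    · rw [if_neg (by linarith)]; rfl

theorem middle_eq (i : Fin 3) : middle i = contraction i (corner (i + 1)) := by
  fin_cases i <;> simp [middle, contraction, add_comm]

theorem dist_corner {i j : Fin 3} (hij : i ≠ j) : dist (corner i) (corner j) = side := by
  obtain ⟨k, hk⟩ : ∃ k, k ≠ i ∧ k ≠ j := by
    revert i j; decide
  rw [dist_eq_of_bary_eq hk.1.symm (by rw [bary_corner, bary_corner, if_neg hk.1, if_neg hk.2]),
    bary_corner, bary_corner, if_pos rfl, if_neg hij]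
  simp

theorem dist_wordMap (w : List (Fin 3)) (x y : ℂ) :
    dist (wordMap w x) (wordMap w y) = (1 / 2) ^ w.length * dist x y := by
  induction w with
  | nil => simp [wordMap]
  | cons i w ih => rw [wordMap, wordMap, dist_contraction, ih, List.length_cons, pow_succ]; ring

/-- The vertices of a triangle have distance one third of the circumference. -/
theorem Summand.dist_vertices (s : Summand) (r : Fin 3) :
    dist (s.vertices r) (s.vertices (r + 1)) = s.perimeter / 3 := by
  cases s with
  | outer =>
    have h1 : Summand.outer.perimeter / 3 = side := by simp [Summand.perimeter, radius, side]
    rw [h1]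
    fin_cases r
    · exact dist_corner (i := 0) (j := 2) (by decide)
    · exact dist_corner (i := 2) (j := 1) (by decide)
    · exact dist_corner (i := 1) (j := 0) (by decide)
  | hole w =>
    change dist (wordMap w (middle r)) (wordMap w (middle (r + 1))) = _
    rw [dist_wordMap, middle_eq, middle_eq, contraction_corner_comm, dist_contraction,
      dist_corner (by revert r; decide)]
    simp only [Summand.perimeter, Summand.radius, side, pow_succ]
    ring

/-- A function that is `1`-Lipschitz along the edges of a triangle is `1`-Lipschitz with respect to
arc length. -/
theorem arcLipschitz_of_edges {s : Summand} {f : gasket → ℂ}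
    (h : ∀ (r : Fin 3) (x y : gasket), (x : ℂ) ∈ segment ℝ (s.vertices r) (s.vertices (r + 1)) →
      (y : ℂ) ∈ segment ℝ (s.vertices r) (s.vertices (r + 1)) → ‖f x - f y‖ ≤ dist x y) :
    ArcLipschitz s f := by
  have hT := s.perimeter_pos.out
  set T := s.perimeter with hTdef
  set F : ℝ → ℂ := fun t => f (s.loop (t : AddCircle s.perimeter)) with hF
  have hper : ∀ (n : ℤ) (t : ℝ), F (t - n * T) = F t := by
    intro n t
    simp only [hF]
    congr 2
    rw [AddCircle.coe_sub]
    have : ((n * T : ℝ) : AddCircle s.perimeter) = 0 := by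
      rw [← zsmul_eq_mul, AddCircle.coe_zsmul, AddCircle.coe_period, smul_zero]
    rw [this, sub_zero]
  have hbase : ∀ (r : Fin 3) (a b : ℝ), (r : ℝ) * (T / 3) ≤ a → a ≤ b →
      b ≤ ((r : ℝ) + 1) * (T / 3) → ‖F a - F b‖ ≤ b - a := by
    intro r a b ha hab hb
    have hr : (r : ℝ) ≤ 2 := by exact_mod_cast Nat.le_of_lt_succ r.2
    have hr0 : (0 : ℝ) ≤ r := by positivity
    have hmem : ∀ t, (r : ℝ) * (T / 3) ≤ t → t ≤ ((r : ℝ) + 1) * (T / 3) →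
        (s.loop (t : AddCircle s.perimeter) : ℂ)
          = AffineMap.lineMap (s.vertices r) (s.vertices (r + 1)) (3 * t / T - r) ∧
        (s.loop (t : AddCircle s.perimeter) : ℂ)
          ∈ segment ℝ (s.vertices r) (s.vertices (r + 1)) := by
      intro t h0 h1
      have e : (s.loop (t : AddCircle s.perimeter) : ℂ)
          = AffineMap.lineMap (s.vertices r) (s.vertices (r + 1)) (3 * t / T - r) := by
        rw [coe_loop_of_mem_Icc s ⟨(by positivity : 0 ≤ (r : ℝ) * (T / 3)).trans h0,
          h1.trans (by rw [← hTdef]; nlinarith)⟩]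
        exact triangleParam_of_mem hT r h0 h1
      refine ⟨e, ?_⟩
      rw [e, segment_eq_image_lineMap]
      refine ⟨_, ⟨?_, ?_⟩, rfl⟩
      · rw [sub_nonneg, le_div_iff₀ hT]; linarith
      · rw [sub_le_iff_le_add, div_le_iff₀ hT]; linarith
    obtain ⟨ea, ma⟩ := hmem a ha (hab.trans hb)
    obtain ⟨eb, mb⟩ := hmem b (ha.trans hab) hb
    refine (h r _ _ ma mb).trans_eq ?_
    rw [Subtype.dist_eq, ea, eb, dist_lineMap_lineMap, s.dist_vertices, dist_comm, Real.dist_eq,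
      sub_sub_sub_cancel_right, ← sub_div, ← mul_sub, abs_of_nonneg (by
        have : 0 ≤ b - a := by linarith
        positivity), ← hTdef]
    field_simp
  have hgrid : ∀ (m : ℤ) (a b : ℝ), m * (T / 3) ≤ a → a ≤ b → b ≤ (m + 1) * (T / 3) →
      ‖F a - F b‖ ≤ b - a := by
    intro m a b ha hab hb
    -- The grid interval is moved into the first period, where `r` is the edge it parametrizes.
    obtain ⟨n, r, rfl⟩ : ∃ (n : ℤ) (r : Fin 3), m = 3 * n + (r : ℕ) := by
      refine ⟨m / 3, ⟨(m % 3).toNat, by omega⟩, ?_⟩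
      simp only
      omega
    push_cast at ha hb
    rw [← hper n a, ← hper n b]
    refine (hbase r _ _ ?_ ?_ ?_).trans_eq ?_ <;> linarith
  have hlip : ∀ a b : ℝ, ‖F a - F b‖ ≤ |b - a| := by
    intro a b
    rcases le_total a b with hab | hab
    · rw [abs_of_nonneg (by linarith)]
      exact norm_sub_le_of_grid (by positivity) hgrid hab
    · rw [abs_of_nonpos (by linarith), norm_sub_rev, neg_sub]
      exact norm_sub_le_of_grid (by positivity) hgrid hab
  intro t q
  obtain ⟨a, rfl⟩ := QuotientAddGroup.mk_surjective q
  have := hlip a (a + t)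
  rw [add_sub_cancel_left] at this
  exact this

/-! ### The distance of a reduced triple -/

theorem distRGT_eq (s : Summand) (x y : gasket) :
    distRGT s x y = ⨆ (f : C(gasket, ℂ)) (_ : ∀ t, t ≠ s → ArcLipschitz t f), edist (f x) (f y) := by
  unfold distRGT connesDist
  simp only [commutatorBoundedBy_sumDirac_iff]
  rfl

/-- The inclusion of the gasket into `ℂ` is admissible, whichever triangle is left out. -/
theorem edist_le_distRGT (s : Summand) (x y : gasket) : edist x y ≤ distRGT s x y := by
  rw [distRGT_eq]
  let f : C(gasket, ℂ) := ⟨Subtype.val, continuous_subtype_val⟩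
  refine le_iSup₂_of_le f (fun t _ => arcLipschitz_of_edges fun r x y _ _ => ?_) le_rfl
  exact (dist_eq_norm _ _).symm.le

theorem segment_subset_triangleEdges (v : Fin 3 → ℂ) (r : Fin 3) :
    segment ℝ (v r) (v (r + 1)) ⊆ triangleEdges v := by
  intro z hz
  fin_cases r
  · exact Or.inl (Or.inl hz)
  · exact Or.inl (Or.inr hz)
  · exact Or.inr hz

theorem image_wordMap_segment (w : List (Fin 3)) (a b : ℂ) :
    wordMap w '' segment ℝ a b = segment ℝ (wordMap w a) (wordMap w b) := by
  induction w with
  | nil => exact Set.image_id _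
  | cons i w ih =>
    simp only [wordMap]
    rw [← image_contraction_segment, ← ih, Set.image_image]

theorem wordCell_middle_mem (w : List (Fin 3)) {i j : Fin 3} (hij : i ≠ j) :
    (wordCell w (cell i (vertex j)) : ℂ) ∈ triangleEdges (Summand.hole w).vertices := by
  have h : ∀ r, (wordCell w (cell r (vertex (r + 1))) : ℂ)
      ∈ triangleEdges (Summand.hole w).vertices := by
    intro r
    refine segment_subset_triangleEdges _ r ?_
    rw [coe_wordCell, coe_cell]
    change wordMap w (contraction r (corner (r + 1))) ∈ _
    rw [← middle_eq]
    exact left_mem_segment _ _ _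
  have hd : j = i + 1 ∨ i = j + 1 := by revert i j; decide
  rcases hd with rfl | rfl
  · exact h i
  · rw [cell_vertex_comm]; exact h j

/-- The holes of consecutive levels touch. -/
theorem wordCell_touch_mem (w : List (Fin 3)) (i : Fin 3) :
    (wordCell w (cell i (cell (i + 1) (vertex (i + 2)))) : ℂ)
      ∈ triangleEdges (Summand.hole w).vertices := by
  refine segment_subset_triangleEdges _ (i + 2) ?_
  change _ ∈ segment ℝ (wordMap w (middle (i + 2))) (wordMap w (middle (i + 2 + 1)))
  rw [coe_wordCell, ← image_wordMap_segment]
  refine Set.mem_image_of_mem _ ?_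
  have e : i + 2 + 1 = i := by revert i; decide
  rw [e, middle_eq, middle_eq, e, segment_eq_image_lineMap]
  refine ⟨1 / 2, ⟨by norm_num, by norm_num⟩, ?_⟩
  simp only [coe_cell, vertex, contraction, AffineMap.lineMap_apply_module, Complex.real_smul]
  push_cast
  ring

theorem Summand.perimeter_hole (w : List (Fin 3)) :
    (Summand.hole w).perimeter = Real.pi * (1 / 2) ^ w.length := by
  simp only [Summand.perimeter, Summand.radius, pow_succ]; ring

/-! ### Oscillation of admissible functions on cells -/

section Oscillation

variable {s : Summand} {f : C(gasket, ℂ)}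

/-- Oscillation bound on a cell in which no hole is missing, through chains of touching holes. -/
theorem norm_sub_le_of_forall_hole_ne (hf : ∀ t, t ≠ s → ArcLipschitz t f) {w : List (Fin 3)}
    (hw : ∀ v, Summand.hole (w ++ v) ≠ s) (x : gasket) :
    ‖f (wordCell w x) - f (wordCell w (cell 0 (vertex 1)))‖ ≤ 3 * Real.pi * (1 / 2) ^ w.length := by
  have hs := side_pos
  -- A finite chain of holes only comes near the given point; `y` is the point it reaches, and
  -- continuity of `f` is used in the limit.
  have key : ∀ (n : ℕ) (w : List (Fin 3)) (_ : ∀ v, Summand.hole (w ++ v) ≠ s) (x : gasket),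
      ∃ y, dist y (wordCell w x) ≤ 2 * side * (1 / 2) ^ (w.length + n) ∧
        ‖f y - f (wordCell w (cell 0 (vertex 1)))‖ ≤ 3 * Real.pi * (1 / 2) ^ w.length := by
    intro n
    induction n with
    | zero =>
      intro w _ x
      refine ⟨wordCell w (cell 0 (vertex 1)), ?_, by rw [sub_self, norm_zero]; positivity⟩
      rw [dist_wordCell, add_zero, mul_comm]
      exact mul_le_mul_of_nonneg_right (dist_le_two_mul_side _ _) (by positivity)
    | succ n ih =>
      intro w hw x
      obtain ⟨i, x, rfl⟩ := exists_cell_eq x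
      obtain ⟨y, hy1, hy2⟩ := ih (w ++ [i]) (fun v => by rw [List.append_assoc]; exact hw _) x
      rw [wordCell_append_singleton, List.length_append, List.length_singleton] at hy1 hy2
      refine ⟨y, hy1.trans_eq (by congr 2; ring), ?_⟩
      have h1 := (hf _ (hw [i])).norm_sub_le_perimeter
        (wordCell_middle_mem (w ++ [i]) (i := 0) (j := 1) (by decide))
        (wordCell_middle_mem (w ++ [i]) (i := i + 1) (j := i + 2) (by simp))
      have h2 := (hf _ (by simpa using hw [])).norm_sub_le_perimeter (wordCell_touch_mem w i)
        (wordCell_middle_mem w (i := 0) (j := 1) (by decide))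
      rw [wordCell_append_singleton] at h1
      rw [wordCell_append_singleton, Summand.perimeter_hole, List.length_append,
        List.length_singleton] at h1
      rw [Summand.perimeter_hole] at h2
      rw [pow_succ] at hy2 h1
      -- In units of `2⁻ⁿ`, `n` the length of `w`: the chain inside the smaller cell costs `3π/2`,
      -- its hole `π/2` and the hole of `w` costs `π`. The sum is `3π` again, so the bound
      -- reproduces itself.
      have h3 := norm_sub_le_norm_sub_add_norm_sub (f y) (f (wordCell w (cell i (cell 0 (vertex 1)))))
        (f (wordCell w (cell 0 (vertex 1))))
      have h4 := norm_sub_le_norm_sub_add_norm_sub (f (wordCell w (cell i (cell 0 (vertex 1)))))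
        (f (wordCell w (cell i (cell (i + 1) (vertex (i + 2)))))) (f (wordCell w (cell 0 (vertex 1))))
      linarith
  choose y hy1 hy2 using fun n => key n w hw x
  have hlim : Tendsto y atTop (𝓝 (wordCell w x)) := by
    rw [tendsto_iff_dist_tendsto_zero]
    refine squeeze_zero (fun n => dist_nonneg) hy1 ?_
    have := (tendsto_pow_atTop_nhds_zero_of_lt_one (by norm_num) (by norm_num : (1 / 2 : ℝ) < 1))
    have := this.const_mul (2 * side * (1 / 2) ^ w.length)
    simpa [pow_add, mul_assoc] using this
  exact le_of_tendsto (((f.continuous.tendsto _).comp hlim).sub_const _).norm (Eventually.of_forall hy2)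

/-- Cells deeper than the omitted hole contain no missing hole. The bound then climbs to larger
cells without loss: two points are joined through a common vertex of two subcells, and twice the
bound of half the size is the bound itself. -/
theorem edist_wordCell_le (hf : ∀ t, t ≠ s → ArcLipschitz t f) (w : List (Fin 3)) (x y : gasket) :
    edist (f (wordCell w x)) (f (wordCell w y))
      ≤ ENNReal.ofReal (6 * Real.pi * (1 / 2) ^ w.length) := by
  rw [edist_dist]
  refine ENNReal.ofReal_le_ofReal ?_
  have hsmall : ∀ (w : List (Fin 3)) (x y : gasket), (∀ v, Summand.hole (w ++ v) ≠ s) →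
      dist (f (wordCell w x)) (f (wordCell w y)) ≤ 6 * Real.pi * (1 / 2) ^ w.length := by
    intro w x y hw
    have h1 := norm_sub_le_of_forall_hole_ne hf hw x
    have h2 := norm_sub_le_of_forall_hole_ne hf hw y
    rw [← dist_eq_norm] at h1 h2
    have := dist_triangle_right (f (wordCell w x)) (f (wordCell w y))
      (f (wordCell w (cell 0 (vertex 1))))
    linarith
  obtain ⟨N, hN⟩ : ∃ N : ℕ, ∀ w : List (Fin 3), N ≤ w.length → ∀ v, Summand.hole (w ++ v) ≠ s := by
    cases s with
    | outer => exact ⟨0, fun w _ v h => by cases h⟩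
    | hole w₀ =>
      refine ⟨w₀.length + 1, fun w hw v h => ?_⟩
      injection h with h
      have := congrArg List.length h
      rw [List.length_append] at this
      omega
  have key : ∀ (k : ℕ) (w : List (Fin 3)) (x y : gasket), N ≤ w.length + k →
      dist (f (wordCell w x)) (f (wordCell w y)) ≤ 6 * Real.pi * (1 / 2) ^ w.length := by
    intro k
    induction k with
    | zero => exact fun w x y h => hsmall w x y (hN w h)
    | succ k ih =>
      intro w x y h
      obtain ⟨i, x, rfl⟩ := exists_cell_eq x
      obtain ⟨j, y, rfl⟩ := exists_cell_eq y
      have h1 := ih (w ++ [i]) x (vertex j) (by simp; omega)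
      have h2 := ih (w ++ [j]) (vertex i) y (by simp; omega)
      rw [wordCell_append_singleton, wordCell_append_singleton, List.length_append,
        List.length_singleton, pow_succ] at h1 h2
      rw [cell_vertex_comm] at h2
      have := dist_triangle (f (wordCell w (cell i x))) (f (wordCell w (cell i (vertex j))))
        (f (wordCell w (cell j y)))
      linarith
  exact key N w x y (by omega)

theorem distRGT_le (s : Summand) (x y : gasket) :
    distRGT s x y ≤ ENNReal.ofReal (8 / side * (6 * Real.pi) * dist x y) := by
  rw [distRGT_eq]
  refine iSup₂_le fun f hf => ?_
  exact le_const_mul_dist (d := fun x y => edist (f x) (f y)) (fun _ => edist_self _)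
    (fun _ _ => (edist_comm _ _).le) (fun _ _ _ => edist_triangle _ _ _)
    (edist_wordCell_le hf) (by positivity) x y

end Oscillation

/-! ### Finiteness and equivalence of the distances -/

theorem distRGT_lt_top (s : Summand) (x y : gasket) : distRGT s x y < ∞ :=
  (distRGT_le s x y).trans_lt ENNReal.ofReal_lt_top

theorem geodesicDist_lt_top (x y : gasket) : geodesicDist x y < ∞ :=
  (geodesicDist_le x y).trans_lt ENNReal.ofReal_lt_top

theorem exists_equivalence_constants (s : Summand) :
    ∃ c C : ℝ≥0, 0 < c ∧ 0 < C ∧ ∀ x y : gasket,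
      c * geodesicDist x y ≤ distRGT s x y ∧ distRGT s x y ≤ C * geodesicDist x y := by
  have hs := side_pos
  have hA : 0 < 8 / side * (8 * side) := by positivity
  have hB : 0 < 8 / side * (6 * Real.pi) := by positivity
  refine ⟨(Real.toNNReal (8 / side * (8 * side)))⁻¹, Real.toNNReal (8 / side * (6 * Real.pi)),
    inv_pos.2 (Real.toNNReal_pos.2 hA), Real.toNNReal_pos.2 hB, fun x y => ⟨?_, ?_⟩⟩
  · refine le_trans ?_ (edist_le_distRGT s x y)
    rw [ENNReal.coe_inv (Real.toNNReal_pos.2 hA).ne', mul_comm, ← div_eq_mul_inv]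
    refine ENNReal.div_le_of_le_mul' ((geodesicDist_le x y).trans_eq ?_)
    rw [ENNReal.ofReal_mul hA.le, edist_dist]; rfl
  · refine (distRGT_le s x y).trans ?_
    rw [ENNReal.ofReal_mul hB.le, ← edist_dist]
    exact mul_le_mul_right (edist_le_geodesicDist x y) _

/-! ### Gluing functions on cells -/

/-- The values of functions on the three cells agree at the common vertices. -/
def Compatible (F : Fin 3 → C(gasket, ℝ)) : Prop :=
  ∀ i j, i ≠ j → F i (vertex j) = F j (vertex i)

/-- The three cell maps form a continuous closed surjection from a compact space, so the gasket
carries the quotient topology. Cells overlap only in common vertices, where compatibility is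
assumed. -/
theorem exists_glue {F : Fin 3 → C(gasket, ℝ)} (hF : Compatible F) :
    ∃ G : C(gasket, ℝ), ∀ i x, G (cell i x) = F i x := by
  let p : C((_ : Fin 3) × gasket, gasket) := ⟨fun q => cell q.1 q.2, by
    rw [continuous_sigma_iff]; exact fun i => (cell i).continuous⟩
  let g : C((_ : Fin 3) × gasket, ℝ) := ⟨fun q => F q.1 q.2, by
    rw [continuous_sigma_iff]; exact fun i => (F i).continuous⟩
  have hp : IsQuotientMap p := by
    refine p.continuous.isClosedMap.isQuotientMap p.continuous fun x => ?_
    obtain ⟨i, y, h⟩ := exists_cell_eq x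
    exact ⟨⟨i, y⟩, h⟩
  have hg : Function.FactorsThrough g p := by
    rintro ⟨i, x⟩ ⟨j, y⟩ h
    change cell i x = cell j y at h
    change F i x = F j y
    by_cases hij : i = j
    · subst hij
      rw [cell_injective i h]
    · obtain ⟨rfl, rfl⟩ := eq_vertex_of_cell_eq hij h
      exact hF i j hij
  refine ⟨hp.lift g hg, fun i x => ?_⟩
  exact DFunLike.congr_fun (hp.lift_comp g hg) ⟨i, x⟩

open Classical in
/-- The function given by `F i` on the `i`-th cell. -/
def glue (F : Fin 3 → C(gasket, ℝ)) : C(gasket, ℝ) :=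
  if h : Compatible F then (exists_glue h).choose else 0

theorem glue_cell {F : Fin 3 → C(gasket, ℝ)} (hF : Compatible F) (i : Fin 3) (x : gasket) :
    glue F (cell i x) = F i x := by
  rw [glue, dif_pos hF]
  exact (exists_glue hF).choose_spec i x

theorem compatible_iff {F : Fin 3 → C(gasket, ℝ)} : Compatible F ↔
    F 0 (vertex 1) = F 1 (vertex 0) ∧ F 0 (vertex 2) = F 2 (vertex 0) ∧
      F 1 (vertex 2) = F 2 (vertex 1) := by
  constructor
  · exact fun h => ⟨h 0 1 (by decide), h 0 2 (by decide), h 1 2 (by decide)⟩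
  · rintro ⟨h1, h2, h3⟩ i j hij
    fin_cases i <;> fin_cases j <;> first | exact absurd rfl hij | assumption | (symm; assumption)

/-! ### Lipschitz functions along edges -/

/-- `f` is `1`-Lipschitz on the side of the gasket opposite to the `k`-th corner. -/
def SideLipschitz (f : gasket → ℝ) (k : Fin 3) : Prop :=
  ∀ x y, coord k x = 0 → coord k y = 0 → |f x - f y| ≤ dist x y

/-- `f` is `1`-Lipschitz on each edge of the hole which belongs to `w`. -/
def HoleLipschitz (f : gasket → ℝ) (w : List (Fin 3)) : Prop :=
  ∀ (r : Fin 3) (x y : gasket),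
    (x : ℂ) ∈ segment ℝ (wordMap w (middle r)) (wordMap w (middle (r + 1))) →
    (y : ℂ) ∈ segment ℝ (wordMap w (middle r)) (wordMap w (middle (r + 1))) →
    |f x - f y| ≤ dist x y

/-- `f` is `1`-Lipschitz on each line parallel to a side. -/
def LineLipschitz (f : gasket → ℝ) : Prop :=
  ∀ k x y, coord k x = coord k y → |f x - f y| ≤ dist x y

/-- On a line parallel to a side, each coordinate that varies measures the Euclidean distance
exactly, up to the factor `side`. -/
theorem lineLipschitz_of_coord {f : gasket → ℝ} (j : Fin 3)
    (h : ∀ x y, |f x - f y| ≤ side * |coord j x - coord j y|) : LineLipschitz f := by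
  intro k x y hk
  refine (h x y).trans ?_
  by_cases hjk : j = k
  · subst hjk
    rw [hk, sub_self, abs_zero, mul_zero]
    exact dist_nonneg
  · exact (dist_eq_of_bary_eq hjk hk).ge

theorem LineLipschitz.side {f : gasket → ℝ} (h : LineLipschitz f) (k : Fin 3) :
    SideLipschitz f k := fun x y hx hy => h k x y (hx.trans hy.symm)

theorem bary_wordMap_congr {k : Fin 3} {x y : ℂ} (h : bary k x = bary k y) (w : List (Fin 3)) :
    bary k (wordMap w x) = bary k (wordMap w y) := by
  induction w with
  | nil => exact h
  | cons i w ih => rw [wordMap, wordMap, bary_contraction, bary_contraction, ih]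

theorem bary_eq_of_mem_segment {k : Fin 3} {a b z : ℂ} (h : bary k a = bary k b)
    (hz : z ∈ segment ℝ a b) : bary k z = bary k a := by
  rw [segment_eq_image_lineMap] at hz
  obtain ⟨t, -, rfl⟩ := hz
  rw [bary_lineMap, ← h]; ring

theorem LineLipschitz.hole {f : gasket → ℝ} (h : LineLipschitz f) (w : List (Fin 3)) :
    HoleLipschitz f w := by
  intro r x y hx hy
  have e : bary (r + 1) (wordMap w (middle r)) = bary (r + 1) (wordMap w (middle (r + 1))) := by
    refine bary_wordMap_congr ?_ w
    rw [middle_eq, middle_eq, bary_contraction, bary_contraction, bary_corner, bary_corner]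
    fin_cases r <;> simp
  exact h (r + 1) x y
    ((bary_eq_of_mem_segment e hx).trans (bary_eq_of_mem_segment e hy).symm)

/-- The side consists of one side from each of the two cells `i ≠ k`, which meet in its midpoint. On
a line distances add up, so Lipschitz pieces concatenate; `g` is the function on the cell before
rescaling. -/
theorem SideLipschitz.of_cells {f : gasket → ℝ} {k : Fin 3}
    (h : ∀ i, i ≠ k → ∃ g : gasket → ℝ, SideLipschitz g k ∧
      ∀ x y, |f (cell i x) - f (cell i y)| ≤ |g x - g y| / 2) : SideLipschitz f k := by
  have hs := side_pos
  have hcell : ∀ i, i ≠ k → ∀ x y, coord k x = 0 → coord k y = 0 →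
      |f (cell i x) - f (cell i y)| ≤ dist (cell i x) (cell i y) := by
    intro i hi x y hx hy
    obtain ⟨g, hg, hfg⟩ := h i hi
    rw [dist_cell]
    exact (hfg x y).trans (div_le_div_of_nonneg_right (hg x y hx hy) zero_le_two)
  have hk : ∀ i x, coord k (cell i x) = 0 → i ≠ k ∧ coord k x = 0 := by
    intro i x hx
    rw [coord_cell] at hx
    have := coord_nonneg k x
    by_cases hik : k = i
    · rw [if_pos hik] at hx; linarith
    · rw [if_neg hik] at hx; exact ⟨fun e => hik e.symm, by linarith⟩
  intro x y hx hy
  obtain ⟨i, x, rfl⟩ := exists_cell_eq x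
  obtain ⟨j, y, rfl⟩ := exists_cell_eq y
  obtain ⟨hi, hx'⟩ := hk i x hx
  obtain ⟨hj, hy'⟩ := hk j y hy
  by_cases hij : i = j
  · subst hij; exact hcell i hi x y hx' hy'
  · have hvj : coord k (vertex j) = 0 := by rw [coord_vertex, if_neg hj.symm]
    have hvi : coord k (vertex i) = 0 := by rw [coord_vertex, if_neg hi.symm]
    have h1 := hcell i hi x (vertex j) hx' hvj
    have h2 := hcell j hj (vertex i) y hvi hy'
    have e1 : dist (cell i x) (cell i (vertex j))
        = side * |coord i (cell i x) - coord i (cell i (vertex j))| :=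
      dist_eq_of_bary_eq hi (hx.trans (by
        change 0 = coord k _
        rw [coord_cell, hvj, if_neg hi.symm]; norm_num))
    have e2 : dist (cell j (vertex i)) (cell j y)
        = side * |coord i (cell j (vertex i)) - coord i (cell j y)| :=
      dist_eq_of_bary_eq hi (Eq.trans (by
        change coord k _ = 0
        rw [coord_cell, hvi, if_neg hj.symm]; norm_num) hy.symm)
    have e3 : dist (cell i x) (cell j y)
        = side * |coord i (cell i x) - coord i (cell j y)| :=
      dist_eq_of_bary_eq hi (hx.trans hy.symm)
    rw [e1] at h1
    rw [e2] at h2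
    rw [cell_vertex_comm j i] at h2
    rw [e3]
    simp only [coord_cell, coord_vertex, if_neg hij, if_true] at h1 h2 ⊢
    have c1 := coord_nonneg i x
    have c2 := coord_le_one i y
    rw [abs_of_nonneg (a := (coord i x + 1) / 2 - (0 + 1) / 2) (by linarith)] at h1
    rw [abs_of_nonneg (a := (0 + 1) / 2 - (coord i y + 0) / 2) (by linarith)] at h2
    rw [abs_of_nonneg (a := (coord i x + 1) / 2 - (coord i y + 0) / 2) (by linarith)]
    have := abs_sub_le (f (cell i x)) (f (cell i (vertex j))) (f (cell j y))
    linarith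

theorem add_one_ne_self (r : Fin 3) : r + 1 ≠ r := by
  revert r; decide

/-- Each edge of the central hole is the side of a cell `i` opposite to its corner `i`. Hence only
this one side of each piece matters. -/
theorem HoleLipschitz.nil_of_cells {f : gasket → ℝ}
    (h : ∀ i, ∃ g : gasket → ℝ, SideLipschitz g i ∧
      ∀ x y, |f (cell i x) - f (cell i y)| ≤ |g x - g y| / 2) : HoleLipschitz f [] := by
  intro r x y hx hy
  obtain ⟨g, hg, hfg⟩ := h (r + 1)
  have hz : ∀ x : gasket, (x : ℂ) ∈ segment ℝ (middle r) (middle (r + 1)) →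
      ∃ z, cell (r + 1) z = x ∧ coord (r + 1) z = 0 := by
    intro x hx
    rw [middle_eq, middle_eq, contraction_corner_comm, ← image_contraction_segment] at hx
    obtain ⟨z, hz, hzx⟩ := hx
    refine ⟨⟨z, segment_corner_subset _ _ hz⟩, Subtype.ext hzx, ?_⟩
    have h1 : bary (r + 1) (corner r) = 0 := by
      rw [bary_corner, if_neg (add_one_ne_self r)]
    have h2 : bary (r + 1) (corner (r + 1 + 1)) = 0 := by
      rw [bary_corner, if_neg (add_one_ne_self (r + 1)).symm]
    exact (bary_eq_of_mem_segment (h1.trans h2.symm) hz).trans h1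
  obtain ⟨x, rfl, hx'⟩ := hz x hx
  obtain ⟨y, rfl, hy'⟩ := hz y hy
  rw [dist_cell]
  exact (hfg x y).trans (div_le_div_of_nonneg_right (hg x y hx' hy') zero_le_two)

theorem HoleLipschitz.cons_of_cell {f g : gasket → ℝ} {i : Fin 3} {w : List (Fin 3)}
    (hg : HoleLipschitz g w)
    (h : ∀ x y, |f (cell i x) - f (cell i y)| ≤ |g x - g y| / 2) : HoleLipschitz f (i :: w) := by
  intro r x y hx hy
  have hm : ∀ k, middle k ∈ gasket := fun k => by
    rw [middle_eq]; exact contraction_mem_gasket _ (corner_mem_gasket _)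
  have hz : ∀ x : gasket,
      (x : ℂ) ∈ segment ℝ (wordMap (i :: w) (middle r)) (wordMap (i :: w) (middle (r + 1))) →
      ∃ z, cell i z = x ∧
        (z : ℂ) ∈ segment ℝ (wordMap w (middle r)) (wordMap w (middle (r + 1))) := by
    intro x hx
    simp only [wordMap] at hx
    rw [← image_contraction_segment] at hx
    obtain ⟨z, hz, hzx⟩ := hx
    have hzK : z ∈ gasket := triangleEdges_vertices_subset (.hole w)
      (segment_subset_triangleEdges (Summand.hole w).vertices r hz)
    exact ⟨⟨z, hzK⟩, Subtype.ext hzx, hz⟩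
  obtain ⟨x, rfl, hx'⟩ := hz x hx
  obtain ⟨y, rfl, hy'⟩ := hz y hy
  rw [dist_cell]
  exact (h x y).trans (div_le_div_of_nonneg_right (hg r x y hx' hy') zero_le_two)

theorem HoleLipschitz.average {f g : gasket → ℝ} {w : List (Fin 3)} (hf : HoleLipschitz f w)
    (hg : HoleLipschitz g w) : HoleLipschitz (fun x => (f x + g x) / 2) w := by
  intro r x y hx hy
  have h1 := abs_le.1 (hf r x y hx hy)
  have h2 := abs_le.1 (hg r x y hx hy)
  exact abs_le.2 ⟨by linarith, by linarith⟩

theorem SideLipschitz.average {f g : gasket → ℝ} {k : Fin 3} (hf : SideLipschitz f k)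
    (hg : SideLipschitz g k) : SideLipschitz (fun x => (f x + g x) / 2) k := by
  intro x y hx hy
  have h1 := abs_le.1 (hf x y hx hy)
  have h2 := abs_le.1 (hg x y hx hy)
  exact abs_le.2 ⟨by linarith, by linarith⟩

theorem lineLipschitz_zero : LineLipschitz fun _ => 0 := fun _ _ _ _ => by simp

/-! ### A function that is steep on one side -/

/-- The hat function `side / 2 * max 0 (2 * coord 2 - 1)` which lives on the top cell. -/
def hat : C(gasket, ℝ) where
  toFun x := side / 2 * max 0 (2 * coord 2 x - 1)
  continuous_toFun := by fun_prop

theorem hat_apply (x : gasket) : hat x = side / 2 * max 0 (2 * coord 2 x - 1) := rfl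

theorem hat_eq_zero {x : gasket} (h : coord 2 x ≤ 1 / 2) : hat x = 0 := by
  rw [hat_apply, max_eq_left (by linarith), mul_zero]

theorem hat_cell_of_ne {i : Fin 3} (hi : 2 ≠ i) (x : gasket) : hat (cell i x) = 0 := by
  refine hat_eq_zero ?_
  rw [coord_cell, if_neg hi]
  linarith [coord_le_one 2 x]

theorem hat_cell_two (x : gasket) : hat (cell 2 x) = side / 2 * coord 2 x := by
  rw [hat_apply, coord_cell, if_pos rfl, max_eq_right (by linarith [coord_nonneg 2 x])]
  ring

/-- The functions on the cells of the self-similar function that is constructed as a fixed point. -/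
def steepStep (G : C(gasket, ℝ)) : Fin 3 → C(gasket, ℝ) :=
  ![(1 / 2 : ℝ) • (G - ContinuousMap.const _ (3 * side / 4)),
    (1 / 2 : ℝ) • (G - hat + ContinuousMap.const _ (3 * side / 4)),
    (side / 4) • (1 - (2 : ℝ) • coord 0)]

theorem steepStep_zero (G : C(gasket, ℝ)) (x : gasket) :
    steepStep G 0 x = (G x - 3 * side / 4) / 2 := by
  simp [steepStep]; ring

theorem steepStep_one (G : C(gasket, ℝ)) (x : gasket) :
    steepStep G 1 x = (G x - hat x + 3 * side / 4) / 2 := by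
  simp [steepStep]; ring

theorem steepStep_two (G : C(gasket, ℝ)) (x : gasket) :
    steepStep G 2 x = side / 4 * (1 - 2 * coord 0 x) := by
  simp [steepStep]

/-- The values on two of the sides that determine the function. -/
def SteepBoundary (G : C(gasket, ℝ)) : Prop :=
  (∀ x, coord 1 x = 0 → G x = -(3 * side / 4) + side * coord 2 x) ∧
    ∀ x, coord 0 x = 0 → G x = hat x + 3 * side / 4 - side * coord 2 x

/-- The boundary data fix the corner values `-3/4`, `3/4` and `1/4` of `side`, and with these the
pieces match: with `0` at the bottom midpoint, and with `-side/4` and `side/4` at the left and right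
ones. -/
theorem SteepBoundary.compatible {G : C(gasket, ℝ)} (h : SteepBoundary G) :
    Compatible (steepStep G) := by
  have h0 := h.1 (vertex 0) (by simp [coord_vertex])
  have h2 := h.1 (vertex 2) (by simp [coord_vertex])
  have h1 := h.2 (vertex 1) (by simp [coord_vertex])
  have e0 : hat (vertex 0) = 0 := hat_eq_zero (by simp [coord_vertex])
  have e1 : hat (vertex 1) = 0 := hat_eq_zero (by simp [coord_vertex])
  have e2 : hat (vertex 2) = side / 2 := by
    rw [hat_apply]; simp [coord_vertex]; norm_num
  rw [compatible_iff]
  simp only [steepStep_zero, steepStep_one, steepStep_two, h0, h1, h2, e0, e1, e2]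
  simp only [coord_vertex, Fin.isValue, Fin.reduceEq, if_false, if_true]
  refine ⟨?_, ?_, ?_⟩ <;> ring

theorem SteepBoundary.glue {G : C(gasket, ℝ)} (h : SteepBoundary G) :
    SteepBoundary (glue (steepStep G)) := by
  have hc := h.compatible
  constructor
  · intro x hx
    obtain ⟨i, x, rfl⟩ := exists_cell_eq x
    have h1 := coord_sum x
    have h2 := coord_nonneg 1 x
    rw [glue_cell hc]
    rw [coord_cell] at hx ⊢
    fin_cases i
    · simp only [Fin.zero_eta, Fin.isValue, one_ne_zero, if_false] at hx
      have hx : coord 1 x = 0 := by linarith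
      simp only [Fin.zero_eta, steepStep_zero, h.1 x hx, Fin.isValue, Fin.reduceEq, if_false]
      ring
    · simp at hx; linarith
    · simp only [Fin.reduceFinMk] at hx
      rw [if_neg (by decide)] at hx
      have h3 : coord 0 x = 1 - coord 2 x := by linarith
      simp only [Fin.reduceFinMk, steepStep_two, h3, if_true]
      ring
  · intro x hx
    obtain ⟨i, x, rfl⟩ := exists_cell_eq x
    have h1 := coord_sum x
    have h2 := coord_nonneg 0 x
    rw [glue_cell hc]
    rw [coord_cell] at hx ⊢
    fin_cases i
    · simp at hx; linarith
    · simp only [Fin.mk_one] at hx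
      rw [if_neg (by decide)] at hx
      have hx : coord 0 x = 0 := by linarith
      simp only [Fin.mk_one, steepStep_one, h.2 x hx, hat_cell_of_ne (by decide : (2 : Fin 3) ≠ 1),
        Fin.isValue, Fin.reduceEq, if_false]
      ring
    · simp only [Fin.reduceFinMk] at hx
      rw [if_neg (by decide)] at hx
      have hx : coord 0 x = 0 := by linarith
      simp only [Fin.reduceFinMk, steepStep_two, hx, hat_cell_two, if_true]
      ring

/-- A starting point for the iteration. The term with the maximum vanishes on the left side and
bends the right side at its midpoint as required. -/
theorem exists_steepBoundary : ∃ G, SteepBoundary G := by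
  have hs := side_pos
  refine ⟨⟨fun x => -(3 * side / 4) + side * coord 2 x
    + max (side * coord 1 x) (2 * side * coord 1 x - side / 2), by fun_prop⟩, ?_, ?_⟩
  · intro x hx
    simp only [ContinuousMap.coe_mk, hx]
    rw [max_eq_left (by linarith)]; ring
  · intro x hx
    have h1 : coord 1 x = 1 - coord 2 x := by linarith [coord_sum x]
    simp only [ContinuousMap.coe_mk, hat_apply, h1]
    rcases le_total (coord 2 x) (1 / 2) with h | h
    · rw [max_eq_right (by nlinarith), max_eq_left (by linarith)]; ring
    · rw [max_eq_left (by nlinarith), max_eq_right (by linarith)]; ring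

theorem isClosed_steepBoundary : IsClosed {G | SteepBoundary G} := by
  have he : ∀ x : gasket, Continuous fun G : C(gasket, ℝ) => G x := fun x =>
    continuous_eval_const x
  simp only [SteepBoundary, Set.ofPred_and, Set.ofPred_forall]
  refine IsClosed.inter (isClosed_iInter fun x => isClosed_iInter fun _ => ?_)
    (isClosed_iInter fun x => isClosed_iInter fun _ => ?_)
  · exact isClosed_eq (he x) continuous_const
  · exact isClosed_eq (he x) continuous_const

/-- Two cells carry halved copies of the function, while the piece on the top cell does not depend
on it. -/
theorem dist_glue_steepStep_le {G G' : C(gasket, ℝ)} (h : SteepBoundary G) (h' : SteepBoundary G') :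
    dist (glue (steepStep G)) (glue (steepStep G')) ≤ 1 / 2 * dist G G' := by
  rw [ContinuousMap.dist_le (by positivity)]
  intro x
  obtain ⟨i, x, rfl⟩ := exists_cell_eq x
  have h1 := ContinuousMap.dist_apply_le_dist (f := G) (g := G') x
  rw [glue_cell h.compatible, glue_cell h'.compatible]
  rw [Real.dist_eq] at h1 ⊢
  have h1 := abs_le.1 h1
  fin_cases i
  · simp only [Fin.zero_eta, steepStep_zero]
    exact abs_le.2 ⟨by linarith, by linarith⟩
  · simp only [Fin.mk_one, steepStep_one]
    exact abs_le.2 ⟨by linarith, by linarith⟩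
  · simp only [Fin.reduceFinMk, steepStep_two, sub_self, abs_zero]
    positivity

theorem exists_steep : ∃ G, SteepBoundary G ∧ glue (steepStep G) = G := by
  have hmaps : Set.MapsTo (fun G => glue (steepStep G)) {G | SteepBoundary G}
      {G | SteepBoundary G} := fun G hG => SteepBoundary.glue hG
  obtain ⟨G₀, hG₀⟩ := exists_steepBoundary
  have hcontr : ContractingWith (1 / 2) (hmaps.restrict _ _ _) := by
    refine ⟨by rw [← NNReal.coe_lt_coe]; norm_num, LipschitzWith.of_dist_le_mul fun G G' => ?_⟩
    exact (dist_glue_steepStep_le G.2 G'.2).trans_eq (by norm_num; rfl)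
  obtain ⟨G, hG, hfix, -⟩ := hcontr.exists_fixedPoint' isClosed_steepBoundary.isComplete hmaps hG₀
    (edist_ne_top _ _)
  exact ⟨G, hG, hfix⟩

/-- A function that has slope `3/2` on the bottom side, but is `1`-Lipschitz on all holes and on
the other sides. -/
def steep : C(gasket, ℝ) := exists_steep.choose

theorem steepBoundary_steep : SteepBoundary steep := exists_steep.choose_spec.1

theorem steep_cell (i : Fin 3) (x : gasket) : steep (cell i x) = steepStep steep i x := by
  have h : glue (steepStep steep) = steep := exists_steep.choose_spec.2
  exact (DFunLike.congr_fun h (cell i x)).symm.trans (glue_cell steepBoundary_steep.compatible i x)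

/-- The variant of `steep` with a different value at the top. -/
def steepLow (x : gasket) : ℝ := steep x - hat x

/-- The profile has slope `side` on `[0, 1/2]` and is constant on `[1/2, 1]`. -/
theorem abs_hat_profile_le {h k : ℝ} :
    |(side * h - side / 2 * max 0 (2 * h - 1)) - (side * k - side / 2 * max 0 (2 * k - 1))|
      ≤ side * |h - k| := by
  have hs := side_pos
  wlog hkh : k ≤ h generalizing h k
  · rw [abs_sub_comm, abs_sub_comm h]
    exact this (le_of_not_ge hkh)
  rw [abs_of_nonneg (sub_nonneg.2 hkh)]
  have h1 : max 0 (2 * k - 1) ≤ max 0 (2 * h - 1) := max_le_max le_rfl (by linarith)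
  have h2 : max 0 (2 * h - 1) ≤ max 0 (2 * k - 1) + 2 * (h - k) :=
    max_le (by linarith [le_max_left 0 (2 * k - 1)]) (by linarith [le_max_right 0 (2 * k - 1)])
  exact abs_le.2 ⟨by nlinarith, by nlinarith⟩

theorem sideLipschitz_of_eq {f : gasket → ℝ} {g : ℝ → ℝ} {k : Fin 3} (hk : 2 ≠ k)
    (hf : ∀ x, coord k x = 0 → f x = g (coord 2 x))
    (hg : ∀ u v, |g u - g v| ≤ side * |u - v|) : SideLipschitz f k := by
  intro x y hx hy
  rw [hf x hx, hf y hy]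
  exact (hg _ _).trans (dist_eq_of_bary_eq hk (hx.trans hy.symm)).ge

theorem sideLipschitz_steep {k : Fin 3} (hk : 2 ≠ k) : SideLipschitz steep k := by
  have hs := side_pos
  have h01 : k = 0 ∨ k = 1 := by revert k; decide
  rcases h01 with rfl | rfl
  · refine sideLipschitz_of_eq hk (g := fun h => 3 * side / 4 - (side * h - side / 2 * max 0 (2 * h - 1)))
      (fun x hx => ?_) fun u v => ?_
    · rw [steepBoundary_steep.2 x hx, hat_apply]; ring
    · rw [sub_sub_sub_cancel_left, abs_sub_comm]
      exact abs_hat_profile_le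
  · refine sideLipschitz_of_eq hk (g := fun h => -(3 * side / 4) + side * h)
      (fun x hx => steepBoundary_steep.1 x hx) fun u v => ?_
    rw [add_sub_add_left_eq_sub, ← mul_sub, abs_mul, abs_of_pos hs]

theorem sideLipschitz_steepLow {k : Fin 3} (hk : 2 ≠ k) : SideLipschitz steepLow k := by
  have hs := side_pos
  have h01 : k = 0 ∨ k = 1 := by revert k; decide
  rcases h01 with rfl | rfl
  · refine sideLipschitz_of_eq hk (g := fun h => 3 * side / 4 - side * h)
      (fun x hx => ?_) fun u v => ?_
    · rw [steepLow, steepBoundary_steep.2 x hx]; ring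
    · rw [sub_sub_sub_cancel_left, ← mul_sub, abs_mul, abs_of_pos hs, abs_sub_comm]
  · refine sideLipschitz_of_eq hk
      (g := fun h => -(3 * side / 4) + (side * h - side / 2 * max 0 (2 * h - 1)))
      (fun x hx => ?_) fun u v => ?_
    · rw [steepLow, steepBoundary_steep.1 x hx, hat_apply]; ring
    · rw [add_sub_add_left_eq_sub]
      exact abs_hat_profile_le

theorem lineLipschitz_coord (j : Fin 3) : LineLipschitz fun x => side * coord j x :=
  lineLipschitz_of_coord j fun x y => by rw [← mul_sub, abs_mul, abs_of_pos side_pos]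

theorem abs_steep_cell_zero (x y : gasket) :
    |steep (cell 0 x) - steep (cell 0 y)| = |steep x - steep y| / 2 := by
  rw [steep_cell, steep_cell, steepStep_zero, steepStep_zero, ← abs_of_pos (zero_lt_two (α := ℝ)),
    ← abs_div, abs_of_pos (zero_lt_two (α := ℝ))]
  congr 1; ring

theorem abs_steep_cell_one (x y : gasket) :
    |steep (cell 1 x) - steep (cell 1 y)| = |steepLow x - steepLow y| / 2 := by
  rw [steep_cell, steep_cell, steepStep_one, steepStep_one, ← abs_of_pos (zero_lt_two (α := ℝ)),
    ← abs_div, abs_of_pos (zero_lt_two (α := ℝ)), steepLow, steepLow]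
  congr 1; ring

theorem abs_steep_cell_two (x y : gasket) :
    |steep (cell 2 x) - steep (cell 2 y)| = |side * coord 0 x - side * coord 0 y| / 2 := by
  rw [steep_cell, steep_cell, steepStep_two, steepStep_two, ← abs_of_pos (zero_lt_two (α := ℝ)),
    ← abs_div, abs_of_pos (zero_lt_two (α := ℝ)), ← abs_neg]
  congr 1; ring

theorem steepLow_cell_of_ne {i : Fin 3} (hi : 2 ≠ i) (x : gasket) :
    steepLow (cell i x) = steep (cell i x) := by
  rw [steepLow, hat_cell_of_ne hi, sub_zero]

theorem abs_steepLow_cell_two (x y : gasket) :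
    |steepLow (cell 2 x) - steepLow (cell 2 y)| = |side * coord 1 x - side * coord 1 y| / 2 := by
  rw [steepLow, steepLow, hat_cell_two, hat_cell_two, steep_cell, steep_cell, steepStep_two,
    steepStep_two, ← abs_of_pos (zero_lt_two (α := ℝ)), ← abs_div, abs_of_pos (zero_lt_two (α := ℝ))]
  congr 1
  -- On the top cell subtracting the hat leaves a function of `coord 1` alone, because the three
  -- coordinates add up to `1`.
  linear_combination (-(side / 2)) * (coord_sum x) + side / 2 * coord_sum y

/-- The induction treats both functions at once, since `steep` on the right cell is a copy of
`steepLow`. They agree on the two lower cells, and on the top cell each depends on a single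
coordinate. The edges of the central hole are covered by the sides on which the pieces are known to
be `1`-Lipschitz; the bottom side never occurs for the steep pieces. -/
theorem holeLipschitz_steep (w : List (Fin 3)) :
    HoleLipschitz steep w ∧ HoleLipschitz steepLow w := by
  have hne0 : (2 : Fin 3) ≠ 0 := by decide
  have hne1 : (2 : Fin 3) ≠ 1 := by decide
  induction w with
  | nil =>
    constructor
    · refine HoleLipschitz.nil_of_cells fun i => ?_
      fin_cases i
      · exact ⟨_, sideLipschitz_steep hne0, fun x y => (abs_steep_cell_zero x y).le⟩
      · exact ⟨_, sideLipschitz_steepLow hne1, fun x y => (abs_steep_cell_one x y).le⟩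
      · exact ⟨_, (lineLipschitz_coord 0).side 2, fun x y => (abs_steep_cell_two x y).le⟩
    · refine HoleLipschitz.nil_of_cells fun i => ?_
      fin_cases i
      · refine ⟨_, sideLipschitz_steep hne0, fun x y => ?_⟩
        exact (steepLow_cell_of_ne hne0 x ▸ steepLow_cell_of_ne hne0 y ▸ abs_steep_cell_zero x y).le
      · refine ⟨_, sideLipschitz_steepLow hne1, fun x y => ?_⟩
        exact (steepLow_cell_of_ne hne1 x ▸ steepLow_cell_of_ne hne1 y ▸ abs_steep_cell_one x y).le
      · exact ⟨_, (lineLipschitz_coord 1).side 2, fun x y => (abs_steepLow_cell_two x y).le⟩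
  | cons i w ih =>
    fin_cases i
    · refine ⟨ih.1.cons_of_cell fun x y => (abs_steep_cell_zero x y).le,
        ih.1.cons_of_cell fun x y => ?_⟩
      exact (steepLow_cell_of_ne hne0 x ▸ steepLow_cell_of_ne hne0 y ▸ abs_steep_cell_zero x y).le
    · refine ⟨ih.2.cons_of_cell fun x y => (abs_steep_cell_one x y).le,
        ih.2.cons_of_cell fun x y => ?_⟩
      exact (steepLow_cell_of_ne hne1 x ▸ steepLow_cell_of_ne hne1 y ▸ abs_steep_cell_one x y).le
    · exact ⟨((lineLipschitz_coord 0).hole w).cons_of_cell fun x y => (abs_steep_cell_two x y).le,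
        ((lineLipschitz_coord 1).hole w).cons_of_cell fun x y => (abs_steepLow_cell_two x y).le⟩

theorem steep_vertex_zero : steep (vertex 0) = -(3 * side / 4) := by
  rw [steepBoundary_steep.1 _ (by simp [coord_vertex])]
  simp [coord_vertex]

theorem steep_vertex_one : steep (vertex 1) = 3 * side / 4 := by
  rw [steepBoundary_steep.2 _ (by simp [coord_vertex]), hat_eq_zero (by simp [coord_vertex])]
  simp [coord_vertex]

theorem steep_vertex_two : steep (vertex 2) = side / 4 := by
  rw [steepBoundary_steep.1 _ (by simp [coord_vertex])]
  simp [coord_vertex]; ring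

theorem hat_vertex_two : hat (vertex 2) = side / 2 := by
  rw [hat_apply]; simp [coord_vertex]; norm_num

/-! ### Functions that separate points at distance `3/2` times the geodesic distance -/

/-- A hat function at the top corner. -/
def cap : C(gasket, ℝ) where
  toFun x := max 0 (side * coord 2 x - side / 4)
  continuous_toFun := by fun_prop

theorem lineLipschitz_cap : LineLipschitz cap :=
  lineLipschitz_of_coord 2 fun x y => by
    have := abs_max_sub_max_le_abs (side * coord 2 x - side / 4) (side * coord 2 y - side / 4) 0
    rw [max_comm _ 0, max_comm _ 0, sub_sub_sub_cancel_right, ← mul_sub, abs_mul,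
      abs_of_pos side_pos] at this
    exact this

theorem cap_vertex {i : Fin 3} (hi : 2 ≠ i) : cap (vertex i) = 0 := by
  have := side_pos
  change max 0 (side * coord 2 (vertex i) - side / 4) = 0
  rw [coord_vertex, if_neg hi]
  exact max_eq_left (by linarith)

theorem cap_vertex_two : cap (vertex 2) = 3 * side / 4 := by
  have := side_pos
  change max 0 (side * coord 2 (vertex 2) - side / 4) = _
  rw [coord_vertex, if_pos rfl, max_eq_right (by linarith)]
  ring

/-- The average of `steep` and `steepLow`, which vanishes at the top. -/
def steepMid : C(gasket, ℝ) := steep - (1 / 2 : ℝ) • hat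

theorem steepMid_eq (x : gasket) : steepMid x = (steep x + steepLow x) / 2 := by
  simp only [steepMid, steepLow, ContinuousMap.sub_apply, ContinuousMap.smul_apply, smul_eq_mul]
  ring

theorem coe_steepMid : (steepMid : gasket → ℝ) = fun x => (steep x + steepLow x) / 2 :=
  funext steepMid_eq

theorem holeLipschitz_steepMid (w : List (Fin 3)) : HoleLipschitz steepMid w := by
  rw [coe_steepMid]
  exact (holeLipschitz_steep w).1.average (holeLipschitz_steep w).2

theorem sideLipschitz_steepMid {k : Fin 3} (hk : 2 ≠ k) : SideLipschitz steepMid k := by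
  rw [coe_steepMid]
  exact (sideLipschitz_steep hk).average (sideLipschitz_steepLow hk)

theorem abs_half_smul_sub (f : C(gasket, ℝ)) (x y : gasket) :
    |((1 / 2 : ℝ) • f) x - ((1 / 2 : ℝ) • f) y| ≤ |f x - f y| / 2 := by
  rw [ContinuousMap.smul_apply, ContinuousMap.smul_apply, ← smul_sub, smul_eq_mul, abs_mul]
  norm_num
  linarith

theorem sideLipschitz_glue {f : Fin 3 → C(gasket, ℝ)}
    (hc : Compatible fun i => (1 / 2 : ℝ) • f i) {k : Fin 3}
    (h : ∀ i, i ≠ k → SideLipschitz (f i) k) : SideLipschitz (glue fun i => (1 / 2 : ℝ) • f i) k :=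
  SideLipschitz.of_cells fun i hi => ⟨f i, h i hi, fun x y => by
    rw [glue_cell hc, glue_cell hc]; exact abs_half_smul_sub _ x y⟩

theorem holeLipschitz_nil_glue {f : Fin 3 → C(gasket, ℝ)}
    (hc : Compatible fun i => (1 / 2 : ℝ) • f i)
    (h : ∀ i, SideLipschitz (f i) i) : HoleLipschitz (glue fun i => (1 / 2 : ℝ) • f i) [] :=
  HoleLipschitz.nil_of_cells fun i => ⟨f i, h i, fun x y => by
    rw [glue_cell hc, glue_cell hc]; exact abs_half_smul_sub _ x y⟩

theorem holeLipschitz_cons_glue {f : Fin 3 → C(gasket, ℝ)}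
    (hc : Compatible fun i => (1 / 2 : ℝ) • f i) {i : Fin 3} {w : List (Fin 3)}
    (h : HoleLipschitz (f i) w) : HoleLipschitz (glue fun i => (1 / 2 : ℝ) • f i) (i :: w) :=
  h.cons_of_cell fun x y => by
    rw [glue_cell hc, glue_cell hc]; exact abs_half_smul_sub _ x y

/-- For each hole there is a function that is `1`-Lipschitz along the outer triangle and all other
holes, but has slope `3/2` between two vertices of the given hole. -/
theorem exists_steep_at_hole (w : List (Fin 3)) :
    ∃ F : C(gasket, ℝ), (∀ i, F (vertex i) = 0) ∧ (∀ k, SideLipschitz F k) ∧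
      (∀ u, u ≠ w → HoleLipschitz F u) ∧
      F (wordCell w (cell 2 (vertex 1))) - F (wordCell w (cell 2 (vertex 0)))
        = 3 * side / 4 * (1 / 2) ^ w.length := by
  have hne0 : (2 : Fin 3) ≠ 0 := by decide
  have hne1 : (2 : Fin 3) ≠ 1 := by decide
  have hh0 : hat (vertex 0) = 0 := hat_eq_zero (by simp [coord_vertex])
  have hh1 : hat (vertex 1) = 0 := hat_eq_zero (by simp [coord_vertex])
  induction w with
  | nil =>
    have m0 : steepMid (vertex 0) = -(3 * side / 4) := by
      simp [steepMid, steep_vertex_zero, hh0]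
    have m1 : steepMid (vertex 1) = 3 * side / 4 := by
      simp [steepMid, steep_vertex_one, hh1]
    have m2 : steepMid (vertex 2) = 0 := by
      simp [steepMid, steep_vertex_two, hat_vertex_two]; ring
    -- The steep side of the top cell is the top edge of the central hole. Its end values `∓3 * side
    -- / 4` are continued by the caps, which vanish at the other two vertices of their cells;
    -- `steepMid` is used because it vanishes at the top corner.
    set f : Fin 3 → C(gasket, ℝ) := ![-cap, cap, steepMid] with hf
    have hf0 : f 0 = -cap := rfl
    have hf1 : f 1 = cap := rfl
    have hf2 : f 2 = steepMid := rfl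
    have hc : Compatible fun i => (1 / 2 : ℝ) • f i := by
      rw [compatible_iff]
      simp [hf0, hf1, hf2, cap_vertex_two, cap_vertex hne0, cap_vertex hne1, m0, m1]
    have hncap : LineLipschitz (-cap : C(gasket, ℝ)) := fun k x y h => by
      rw [ContinuousMap.neg_apply, ContinuousMap.neg_apply, neg_sub_neg, abs_sub_comm]
      exact lineLipschitz_cap k x y h
    refine ⟨glue fun i => (1 / 2 : ℝ) • f i, fun i => ?_, fun k => ?_, fun u hu => ?_, ?_⟩
    · rw [← cell_vertex_self i, glue_cell hc]
      fin_cases i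
      · simp [hf0, cap_vertex hne0]
      · simp [hf1, cap_vertex hne1]
      · simp [hf2, m2]
    · refine sideLipschitz_glue hc fun i hi => ?_
      fin_cases i
      · exact hncap.side k
      · exact lineLipschitz_cap.side k
      · exact sideLipschitz_steepMid hi
    · obtain ⟨i, u, rfl⟩ := List.exists_cons_of_ne_nil hu
      refine holeLipschitz_cons_glue hc ?_
      fin_cases i
      · exact hncap.hole u
      · exact lineLipschitz_cap.hole u
      · exact holeLipschitz_steepMid u
    · simp only [wordCell_nil]
      rw [glue_cell hc, glue_cell hc, hf2]
      simp [m0, m1]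
      ring
  | cons j w ih =>
    obtain ⟨F, hv, hside, hhole, hval⟩ := ih
    -- Vanishing at the corners allows extension by zero to the other cells, and the Lipschitz
    -- bounds on the sides take care of the central hole.
    set f : Fin 3 → C(gasket, ℝ) := fun i => if i = j then F else 0 with hf
    have hfv : ∀ i k, f i (vertex k) = 0 := by
      intro i k
      simp only [hf]
      split_ifs
      · exact hv k
      · rfl
    have hc : Compatible fun i => (1 / 2 : ℝ) • f i := by
      intro i k _
      simp [hfv]
    have hfs : ∀ i k, SideLipschitz (f i) k := by
      intro i k
      simp only [hf]
      split_ifs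
      · exact hside k
      · exact lineLipschitz_zero.side k
    refine ⟨glue fun i => (1 / 2 : ℝ) • f i, fun i => ?_, fun k => ?_, fun u hu => ?_, ?_⟩
    · rw [← cell_vertex_self i, glue_cell hc]
      simp [hfv]
    · exact sideLipschitz_glue hc fun i _ => hfs i k
    · cases u with
      | nil => exact holeLipschitz_nil_glue hc fun i => hfs i i
      | cons i u =>
        refine holeLipschitz_cons_glue hc ?_
        simp only [hf]
        split_ifs with hij
        · subst hij
          exact hhole u fun h => hu (h ▸ rfl)
        · exact lineLipschitz_zero.hole u
    · have hfj : f j = F := if_pos rfl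
      rw [wordCell_cons, wordCell_cons, glue_cell hc, glue_cell hc, hfj, ContinuousMap.smul_apply,
        ContinuousMap.smul_apply, ← smul_sub, hval, smul_eq_mul, List.length_cons, pow_succ]
      ring

/-! ### Points at which the two distances differ -/

/-- A real function, regarded as a complex one. -/
def complexify (f : C(gasket, ℝ)) : C(gasket, ℂ) where
  toFun x := (f x : ℂ)
  continuous_toFun := by fun_prop

theorem norm_complexify_sub (f : C(gasket, ℝ)) (x y : gasket) :
    ‖complexify f x - complexify f y‖ = |f x - f y| := by
  change ‖(f x : ℂ) - f y‖ = _
  rw [← Complex.ofReal_sub, Complex.norm_real, Real.norm_eq_abs]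

theorem HoleLipschitz.arcLipschitz {f : C(gasket, ℝ)} {w : List (Fin 3)} (h : HoleLipschitz f w) :
    ArcLipschitz (.hole w) (complexify f) :=
  arcLipschitz_of_edges fun r x y hx hy => (norm_complexify_sub f x y).trans_le (h r x y hx hy)

theorem arcLipschitz_outer {f : C(gasket, ℝ)} (h : ∀ k, SideLipschitz f k) :
    ArcLipschitz .outer (complexify f) := by
  refine arcLipschitz_of_edges fun r x y hx hy => (norm_complexify_sub f x y).trans_le ?_
  obtain ⟨k, hk1, hk2⟩ : ∃ k, bary k (Summand.outer.vertices r) = 0 ∧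
      bary k (Summand.outer.vertices (r + 1)) = 0 := by
    fin_cases r
    · exact ⟨1, by simp [Summand.vertices, bary_corner], by simp [Summand.vertices, bary_corner]⟩
    · exact ⟨0, by simp [Summand.vertices, bary_corner], by simp [Summand.vertices, bary_corner]⟩
    · exact ⟨2, by simp [Summand.vertices, bary_corner], by simp [Summand.vertices, bary_corner]⟩
  have e := hk1.trans hk2.symm
  exact h k x y ((bary_eq_of_mem_segment e hx).trans hk1) ((bary_eq_of_mem_segment e hy).trans hk1)

/-- Along a segment inside the gasket the geodesic distance is at most the Euclidean one, so one
admissible function with slope `3/2` between the end points suffices. -/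
theorem three_half_mul_geodesicDist_le {s : Summand} {F : C(gasket, ℝ)}
    (hF : ∀ t, t ≠ s → ArcLipschitz t (complexify F)) {x y : gasket}
    (hseg : segment ℝ (x : ℂ) y ⊆ gasket) (h : 3 / 2 * dist x y ≤ |F x - F y|) :
    3 / 2 * geodesicDist x y ≤ distRGT s x y := by
  rw [distRGT_eq]
  refine le_iSup₂_of_le (complexify F) hF ?_
  rw [edist_dist, dist_eq_norm, norm_complexify_sub]
  have e : (3 / 2 : ℝ≥0∞) = ENNReal.ofReal (3 / 2) := by
    rw [ENNReal.ofReal_div_of_pos two_pos]; simp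
  calc 3 / 2 * geodesicDist x y ≤ 3 / 2 * ENNReal.ofReal (dist x y) :=
        mul_le_mul_right (geodesicDist_le_of_segment_subset hseg) _
    _ = ENNReal.ofReal (3 / 2 * dist x y) := by rw [e, ENNReal.ofReal_mul (by norm_num)]
    _ ≤ _ := ENNReal.ofReal_le_ofReal h

/-- The points are the end points of the bottom side if the outer triangle is omitted, and those of
the top edge of the hole if a hole is. -/
theorem exists_three_half (s : Summand) :
    ∃ x y : gasket, x ≠ y ∧ 3 / 2 * geodesicDist x y ≤ distRGT s x y := by
  have hs := side_pos
  have hv : dist (vertex 0) (vertex 1) = side := dist_corner (by decide)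
  cases s with
  | outer =>
    refine ⟨vertex 0, vertex 1, fun h => ?_, three_half_mul_geodesicDist_le (F := steep) ?_
      (segment_corner_subset 0 1) ?_⟩
    · rw [h, dist_self] at hv; linarith
    · rintro (_ | w) ht
      · exact absurd rfl ht
      · exact (holeLipschitz_steep w).1.arcLipschitz
    · rw [hv, steep_vertex_zero, steep_vertex_one, abs_of_nonpos (by linarith)]
      linarith
  | hole w =>
    obtain ⟨F, -, hside, hhole, hval⟩ := exists_steep_at_hole w
    have hd : dist (wordCell w (cell 2 (vertex 0))) (wordCell w (cell 2 (vertex 1)))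
        = (1 / 2) ^ w.length * (side / 2) := by
      rw [dist_wordCell, dist_cell, hv]
    have hp : (0 : ℝ) < (1 / 2) ^ w.length := by positivity
    refine ⟨wordCell w (cell 2 (vertex 0)), wordCell w (cell 2 (vertex 1)), fun h => ?_,
      three_half_mul_geodesicDist_le (F := F) ?_ ?_ ?_⟩
    · rw [h, dist_self] at hd
      have : 0 < (1 / 2 : ℝ) ^ w.length * (side / 2) := by positivity
      linarith
    · rintro (_ | u) ht
      · exact arcLipschitz_outer hside
      · exact (hhole u fun h => ht (h ▸ rfl)).arcLipschitz
    · rw [coe_wordCell, coe_wordCell]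
      refine segment_wordMap_subset ?_ w
      rw [coe_cell, coe_cell, ← image_contraction_segment]
      rintro _ ⟨z, hz, rfl⟩
      exact contraction_mem_gasket 2 (segment_corner_subset 0 1 hz)
    · rw [abs_sub_comm, hval, hd]
      refine le_trans (le_of_eq ?_) (le_abs_self _)
      ring

/-- The factor `3/2` excludes equality because the geodesic distance of the two points is positive
and finite. -/
theorem distRGT_ne_geodesicDist (s : Summand) : distRGT s ≠ geodesicDist := by
  intro h
  obtain ⟨x, y, hxy, hle⟩ := exists_three_half s
  rw [h] at hle
  have h0 : geodesicDist x y ≠ 0 := fun h0 =>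
    hxy (edist_eq_zero.1 (le_antisymm ((edist_le_geodesicDist x y).trans_eq h0) zero_le))
  have h1 : (1 : ℝ≥0∞) < 3 / 2 := by
    rw [ENNReal.lt_div_iff_mul_lt (by simp) (by simp)]; norm_num
  have h2 := ENNReal.mul_lt_mul_left h0 (geodesicDist_lt_top x y).ne h1
  rw [one_mul] at h2
  exact absurd hle (not_le.2 h2)

end Gasket

end

theorem proposition4p1 (s : Gasket.Summand) :
    (∀ x y : Gasket.gasket, Gasket.geodesicDist x y < ∞ ∧ Gasket.distRGT s x y < ∞) ∧
    (∃ c C : ℝ≥0, 0 < c ∧ 0 < C ∧ ∀ x y : Gasket.gasket,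
      c * Gasket.geodesicDist x y ≤ Gasket.distRGT s x y ∧
        Gasket.distRGT s x y ≤ C * Gasket.geodesicDist x y) ∧
    Gasket.distRGT s ≠ Gasket.geodesicDist ∧
    ∃ x y : Gasket.gasket, x ≠ y ∧ 3 / 2 * Gasket.geodesicDist x y ≤ Gasket.distRGT s x y :=
  ⟨fun x y => ⟨Gasket.geodesicDist_lt_top x y, Gasket.distRGT_lt_top s x y⟩,
    Gasket.exists_equivalence_constants s, Gasket.distRGT_ne_geodesicDist s,
    Gasket.exists_three_half s⟩
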